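/- Let $(\Omega,\mathcal F,\mathbb P)$ be a probability space and let $\theta:\Omega\to\Omega$ be an invertible, bi-measurable transformation preserving $\mathbb P$. Let $\mathcal F_0\subset\mathcal F$ be a $\sigma$-algebra with $\mathcal F_0\subset\theta^{-1}(\mathcal F_0)$, and for $n\in\mathbb Z$ put $\mathcal F_n=\theta^{-n}(\mathcal F_0)$, $\mathbb E_n=\mathbb E(\cdot\mid\mathcal F_n)$ and $P_n=\mathbb E_n-\mathbb E_{n-1}$; put also $\mathbb E_{-\infty}=\mathbb E(\cdot\mid\bigcap_n\mathcal F_n)$ and $\mathbb E_{\infty}=\mathbb E(\cdot\mid\bigvee_n\mathcal F_n)$. Let $(\mathcal X,|\cdot|)$ be a separable real Banach space that is $(2,D)$-smooth for some $D\ge 1$. This means that there is $L_0\ge 1$ with $|x+y|^2+|x-y|^2\le 2(|x|^2+L_0^2|y|^2)$ for all $x,y\in\mathcal X$, and that $\mathbb E\big(|d_1+\dots+d_N|^2\big)\le D^2\sum_{n=1}^N\mathbb E(|d_n|^2)$ for all $\mathcal X$-valued martingale differences $(d_n)_{1\le n\le N}$ on any probability space. Let $X\in L^2(\Omega,\mathcal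 F,\mathbb P,\mathcal X)$ be regular, i.e. $\mathbb E_{-\infty}(X)=0$ and $\mathbb E_{\infty}(X)=X$ almost surely, and assume $$\|X\|_{H_2}:=\sum_{n\in\mathbb Z}\|P_nX\|_{2}<\infty,\qquad \|Z\|_2:=(\mathbb E|Z|^2)^{1/2}.$$ Write $S_n=\sum_{k=0}^{n-1}X\circ\theta^k$, $L=\max(\log,1)$, $\mathcal M_2(X)=\sup_{n\ge1}\frac{|S_n|}{\sqrt{nL(L(n))}}$, and $\|f\|_{p,\infty}=\sup_{t>0}t\,\mathbb P(|f|>t)^{1/p}$. Then for every $1\le p<2$, $$\|\mathcal M_2(X)\|_{p,\infty}\le C_p\,D\,\|X\|_{H_2},$$ where $C_p>0$ is a universal constant depending only on $p$. Moreover, the series $d=\sum_{n\in\mathbb Z}P_1(X\circ\theta^n)$ converges in $L^2(\Omega,\mathcal F_1,\mathbb P,\mathcal X)$, $\mathbb E_0(d)=0$, and, with $M_n=\sum_{k=0}^{n-1}d\circ\theta^k$, $$|S_n-M_n|=o\big(\sqrt{nL(L(n))}\big)\qquad\mathbb P\text{-almost surely}.$$ -/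

import Mathlib

open MeasureTheory ProbabilityTheory Filter Topology Asymptotics
open scoped ENNReal

universe u v

noncomputable section

namespace HannanLIL

/-- `d 0, d 1, …` is a sequence of martingale differences with respect to the filtration `𝒢`:
`d n` is integrable, `𝒢 (n + 1)`-measurable, and `E(d n | 𝒢 n) = 0` almost surely. -/
structure IsMartingaleDiff {Ω : Type u} {E : Type v} [NormedAddCommGroup E] [NormedSpace ℝ E]
    [CompleteSpace E] [mΩ : MeasurableSpace Ω] (μ : Measure Ω) (𝒢 : Filtration ℕ mΩ)
    (d : ℕ → Ω → E) : Prop where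
  integrable : ∀ n, Integrable (d n) μ
  stronglyMeasurable : ∀ n, StronglyMeasurable[𝒢 (n + 1)] (d n)
  condExp_eq_zero : ∀ n, μ[d n | 𝒢 n] =ᵐ[μ] 0

/-- `(2, D)`-smooth Banach spaces: `E` is `2`-smooth, and the second moments of all `E`-valued
square-integrable martingales, on all probability spaces, are controlled by those of
their differences with the constant `D`. (For differences that are not all square-integrable the
inequality holds trivially, its right-hand side being infinite. The universe `u` of the probability
spaces is immaterial.) -/
structure IsTwoSmooth (E : Type v) [NormedAddCommGroup E] [NormedSpace ℝ E]
    [CompleteSpace E] (D : ℝ) : Prop where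
  two_smooth : ∃ L : ℝ, 1 ≤ L ∧
    ∀ x y : E, ‖x + y‖ ^ 2 + ‖x - y‖ ^ 2 ≤ 2 * (‖x‖ ^ 2 + L ^ 2 * ‖y‖ ^ 2)
  one_le : 1 ≤ D
  moment_le : ∀ (Ω : Type u) [mΩ : MeasurableSpace Ω] (μ : Measure Ω) [IsProbabilityMeasure μ]
    (𝒢 : Filtration ℕ mΩ) (d : ℕ → Ω → E), IsMartingaleDiff μ 𝒢 d → (∀ n, MemLp (d n) 2 μ) →
    ∀ N : ℕ, ∫ ω, ‖∑ n ∈ Finset.range N, d n ω‖ ^ 2 ∂μ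
      ≤ D ^ 2 * ∑ n ∈ Finset.range N, ∫ ω, ‖d n ω‖ ^ 2 ∂μ

/-- The function `L = max (log, 1)`. -/
def L (x : ℝ) : ℝ := max (Real.log x) 1

/-- The normalisation `√(n L(L(n)))` of the law of the iterated logarithm. -/
def lilRate (n : ℕ) : ℝ := Real.sqrt (n * L (L n))

/-- The weak `L^p` quasi-norm `sup_{t > 0} t P(f > t)^{1/p}` of a function `f ≥ 0`. -/
def weakNorm {Ω : Type u} [MeasurableSpace Ω] (f : Ω → ℝ≥0∞) (p : ℝ) (μ : Measure Ω) : ℝ≥0∞ :=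
  ⨆ (t : ℝ) (_ : 0 < t), ENNReal.ofReal t * μ {ω | ENNReal.ofReal t < f ω} ^ (1 / p)

section

variable {Ω : Type u} {E : Type v} [NormedAddCommGroup E]

/-- `M₂(X) = sup_{n ≥ 1} ‖S_n(X)‖ / √(n L(L(n)))`, where `S_n(X) = ∑_{k < n} X ∘ θ^k`
is the Birkhoff sum. -/
def maxFun (θ : Equiv.Perm Ω) (X : Ω → E) (ω : Ω) : ℝ≥0∞ :=
  ⨆ (n : ℕ) (_ : 1 ≤ n), ‖birkhoffSum θ X n ω‖ₑ / ENNReal.ofReal (lilRate n)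

/-- `F_n = θ^{-n}(F₀)`, for `n ∈ ℤ`. -/
abbrev filt (F₀ : MeasurableSpace Ω) (θ : Equiv.Perm Ω) (n : ℤ) : MeasurableSpace Ω :=
  F₀.comap (θ ^ n : Equiv.Perm Ω)

variable [NormedSpace ℝ E] [CompleteSpace E]

/-- `P_n X = E(X | F_n) - E(X | F_{n-1})`. -/
def proj (F₀ : MeasurableSpace Ω) [MeasurableSpace Ω] (μ : Measure Ω) (θ : Equiv.Perm Ω) (n : ℤ)
    (X : Ω → E) : Ω → E :=
  μ[X | filt F₀ θ n] - μ[X | filt F₀ θ (n - 1)]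

/-- `X` is regular: `E(X | ⋂ F_n) = 0` and `X - E(X | ⋁ F_n) = 0` almost surely. -/
def IsRegular (F₀ : MeasurableSpace Ω) [MeasurableSpace Ω] (μ : Measure Ω) (θ : Equiv.Perm Ω)
    (X : Ω → E) : Prop :=
  μ[X | ⨅ n : ℤ, filt F₀ θ n] =ᵐ[μ] 0 ∧ X - μ[X | ⨆ n : ℤ, filt F₀ θ n] =ᵐ[μ] 0

/-- `‖X‖_{H₂} = ∑_{n ∈ ℤ} ‖P_n X‖₂`, as an element of `[0, ∞]`. -/
def hannanNorm (F₀ : MeasurableSpace Ω) [MeasurableSpace Ω] (μ : Measure Ω) (θ : Equiv.Perm Ω)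
    (X : Ω → E) : ℝ≥0∞ :=
  ∑' n : ℤ, eLpNorm (proj F₀ μ θ n X) 2 μ

end

end HannanLIL

end

/-! Regularity and summability of the projections give `X = ∑ P_n X` almost surely (`hasSum_proj`),
and for each `n` the sequence `(P_n X) ∘ θ^k` is a stationary sequence of martingale differences. It
therefore suffices to bound the maximal function of one such sequence by `C_p D ‖d‖₂`
(`lpSize_maxFun_le`). This is done in the strong `L^p` norm, which obeys Minkowski's inequality with
constant one and dominates the weak norm, so the bounds add up to the Hannan norm.

The maximal inequality rests on an exponential bound extracted from second moments alone
(`IsClocked.measure_lt_norm_sum_le`). Let the conditional second moments be at most `a`, call their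
running sum the clock, and put `s = 4 D √a`. Restart the path each time it has moved by more than
`s` or the clock has advanced by more than `a`. Until such an exit the clock uses at most `2a`, so
Chebyshev's inequality and smoothness give an exit through the martingale probability at most `1/8`,
conditionally on the past. Since `4 · 1/8 + 1/2 · 1 = 1`, the weight `4^(space exits) / 2^(clock
exits)` has mean at most one. If the clock stays below `K a` there are at most `K + 1` clock exits,
so a displacement of order `D √a K`, jumps above `√a` set aside, forces many space exits and a
weight of at least `2^(3K-1)`. Markov's inequality concludes.

For stationary differences this is applied on the blocks `n ≤ 2^j`, with `ℓ_j` of order `log j`,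
truncation `a_j = c² 2^j / ℓ_j` and `K = κ ℓ_j` (`measure_lt_norm_birkhoffSum_le`). The exponential
bounds are summable in `j`. The maximal ergodic theorem controls the clock at all scales at once.
The parts removed by truncation are handled by Markov's inequality, and are summable because `√(2^j
/ ℓ_j)` grows geometrically. Optimising `κ` yields tails of order `m / 4^m` at height `2^m`, hence
all moments `p < 2`.

For the approximation, `P_1(X ∘ θ^(1-n)) = (P_n X) ∘ θ^(1-n)` differs from `P_n X` by a coboundary.
Its Birkhoff sums telescope and are negligible by Borel–Cantelli. Summability of the maximal
functions then allows dominated convergence over `n` (`isLittleO_birkhoffSum_of_hasSum`). -/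

set_option linter.unusedSectionVars false

noncomputable section

namespace HannanLIL

/-! ### Exponential concentration of martingales from second moments -/

section Concentration

variable {Ω : Type u} {E : Type v} [NormedAddCommGroup E] [NormedSpace ℝ E] [CompleteSpace E]
  [mΩ : MeasurableSpace Ω] {μ : Measure Ω} [IsProbabilityMeasure μ] {𝒢 : Filtration ℕ mΩ}

/-- Square-integrable martingale differences `d n` together with a predictable bound `h n`,
at most `a`, for their conditional second moments. -/
structure IsClocked (μ : Measure Ω) (𝒢 : Filtration ℕ mΩ) (a : ℝ) (d : ℕ → Ω → E)
    (h : ℕ → Ω → ℝ) : Prop where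
  diff : IsMartingaleDiff μ 𝒢 d
  memLp : ∀ n, MemLp (d n) 2 μ
  measurable : ∀ n, Measurable[𝒢 n] (h n)
  nonneg : ∀ n ω, 0 ≤ h n ω
  le : ∀ n ω, h n ω ≤ a
  sq_le : ∀ n s, MeasurableSet[𝒢 n] s → ∫ ω in s, ‖d n ω‖ ^ 2 ∂μ ≤ ∫ ω in s, h n ω ∂μ

lemma IsMartingaleDiff.indicator {d : ℕ → Ω → E} (hd : IsMartingaleDiff μ 𝒢 d)
    {G : ℕ → Set Ω} (hG : ∀ n, MeasurableSet[𝒢 n] (G n)) :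
    IsMartingaleDiff μ 𝒢 (fun n => (G n).indicator (d n)) where
  integrable n := (hd.integrable n).indicator (𝒢.le n _ (hG n))
  stronglyMeasurable n :=
    (hd.stronglyMeasurable n).indicator (𝒢.mono (Nat.le_succ n) _ (hG n))
  condExp_eq_zero n := by
    refine (condExp_indicator (hd.integrable n) (hG n)).trans ?_
    filter_upwards [hd.condExp_eq_zero n] with ω hω
    simp only [Set.indicator, hω]
    split_ifs <;> rfl

/-- Between the times `k` and `i`, the martingale moves by at most `s` and the clock by at
most `a`. -/
def calm (d : ℕ → Ω → E) (h : ℕ → Ω → ℝ) (s a : ℝ) (k i : ℕ) : Set Ω :=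
  {ω | ‖∑ l ∈ Finset.Ico k i, d l ω‖ ≤ s ∧ ∑ l ∈ Finset.Ico k i, h l ω ≤ a}

/-- No exit happens in `(k, i]`. -/
def stay (d : ℕ → Ω → E) (h : ℕ → Ω → ℝ) (s a : ℝ) (k i : ℕ) : Set Ω :=
  {ω | ∀ j, k < j → j ≤ i → ω ∈ calm d h s a k j}

/-- The first exit after `k` is at time `i + 1`, and it is due to the martingale. -/
def spaceExit (d : ℕ → Ω → E) (h : ℕ → Ω → ℝ) (s a : ℝ) (k i : ℕ) : Set Ω :=
  stay d h s a k i ∩ {ω | s < ‖∑ l ∈ Finset.Ico k (i + 1), d l ω‖}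

/-- The first exit after `k` is at time `i + 1`, and it is due to the clock or to the horizon `N`. -/
def clockExit (d : ℕ → Ω → E) (h : ℕ → Ω → ℝ) (s a : ℝ) (N k i : ℕ) : Set Ω :=
  stay d h s a k i ∩ ({ω | s < ‖∑ l ∈ Finset.Ico k (i + 1), d l ω‖}ᶜ ∩
    {ω | a < ∑ l ∈ Finset.Ico k (i + 1), h l ω ∨ i + 1 = N})

/-- The weight `4 ^ (number of space exits) / 2 ^ (number of clock exits)` of the path
restarted at time `k`, where at most `f` exits are counted. -/
def weight (d : ℕ → Ω → E) (h : ℕ → Ω → ℝ) (s a : ℝ) (N : ℕ) : ℕ → ℕ → Ω → ℝ≥0∞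
  | 0, _, _ => 1
  | f + 1, k, ω => if N ≤ k then 1 else ∑ i ∈ Finset.Ico k N,
      ((spaceExit d h s a k i).indicator (fun ω => 4 * weight d h s a N f (i + 1) ω) ω +
        (clockExit d h s a N k i).indicator (fun ω => 2⁻¹ * weight d h s a N f (i + 1) ω) ω)

variable {d : ℕ → Ω → E} {h : ℕ → Ω → ℝ} {s a : ℝ}

lemma IsClocked.stronglyMeasurable_sum (H : IsClocked μ 𝒢 a d h) (k i : ℕ) :
    StronglyMeasurable[𝒢 i] (fun ω => ∑ l ∈ Finset.Ico k i, d l ω) :=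
  Finset.stronglyMeasurable_fun_sum _ fun l hl =>
    (H.diff.stronglyMeasurable l).mono (𝒢.mono (by have := Finset.mem_Ico.1 hl; omega))

lemma IsClocked.measurableSet_space (H : IsClocked μ 𝒢 a d h) (k i : ℕ) :
    MeasurableSet[𝒢 i] {ω | s < ‖∑ l ∈ Finset.Ico k i, d l ω‖} :=
  measurableSet_lt (mδ := 𝒢 i) measurable_const (H.stronglyMeasurable_sum k i).norm.measurable

lemma IsClocked.measurable_clock (H : IsClocked μ 𝒢 a d h) (k i : ℕ) :
    Measurable[𝒢 i] (fun ω => ∑ l ∈ Finset.Ico k i, h l ω) :=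
  Finset.measurable_fun_sum _ fun l hl =>
    (H.measurable l).mono (𝒢.mono (by have := Finset.mem_Ico.1 hl; omega)) le_rfl

lemma IsClocked.measurableSet_calm (H : IsClocked μ 𝒢 a d h) (k i : ℕ) :
    MeasurableSet[𝒢 i] (calm d h s a k i) :=
  (measurableSet_le (mδ := 𝒢 i) (H.stronglyMeasurable_sum k i).norm.measurable
    measurable_const).inter
    (measurableSet_le (mδ := 𝒢 i) (H.measurable_clock k i) measurable_const)

lemma IsClocked.measurableSet_stay (H : IsClocked μ 𝒢 a d h) (k i : ℕ) :
    MeasurableSet[𝒢 i] (stay d h s a k i) := by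
  have : stay d h s a k i = ⋂ j ∈ Finset.Ioc k i, calm d h s a k j := by
    ext ω
    simp [stay]
  rw [this]
  exact Finset.measurableSet_biInter _ fun j hj =>
    𝒢.mono (Finset.mem_Ioc.1 hj).2 _ (H.measurableSet_calm k j)

lemma IsClocked.measurableSet_spaceExit (H : IsClocked μ 𝒢 a d h) (k i : ℕ) :
    MeasurableSet[𝒢 (i + 1)] (spaceExit d h s a k i) :=
  (𝒢.mono (Nat.le_succ i) _ (H.measurableSet_stay k i)).inter (H.measurableSet_space k (i + 1))

lemma IsClocked.measurableSet_clockExit (H : IsClocked μ 𝒢 a d h) (N k i : ℕ) :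
    MeasurableSet[𝒢 (i + 1)] (clockExit d h s a N k i) := by
  refine (𝒢.mono (Nat.le_succ i) _ (H.measurableSet_stay k i)).inter
    ((H.measurableSet_space k (i + 1)).compl.inter ?_)
  exact (measurableSet_lt (mδ := 𝒢 (i + 1)) measurable_const
    (H.measurable_clock k (i + 1))).union (.const _)

lemma IsClocked.measurable_weight (H : IsClocked μ 𝒢 a d h) (N f : ℕ) :
    ∀ k, Measurable (weight d h s a N f k) := by
  induction f with
  | zero => intro k; exact measurable_const
  | succ f ih =>
    intro k
    by_cases hk : N ≤ k
    · have : weight d h s a N (f + 1) k = fun _ => 1 := by ext ω; simp [weight, hk]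
      rw [this]; exact measurable_const
    · have : weight d h s a N (f + 1) k = fun ω => ∑ i ∈ Finset.Ico k N,
      ((spaceExit d h s a k i).indicator (fun ω => 4 * weight d h s a N f (i + 1) ω) ω +
        (clockExit d h s a N k i).indicator (fun ω => 2⁻¹ * weight d h s a N f (i + 1) ω) ω) := by
        ext ω; simp [weight, hk]
      rw [this]
      refine Finset.measurable_fun_sum _ fun i _ => ?_
      exact (((ih (i + 1)).const_mul 4).indicator (𝒢.le _ _ (H.measurableSet_spaceExit k i))).add
        (((ih (i + 1)).const_mul 2⁻¹).indicator (𝒢.le _ _ (H.measurableSet_clockExit N k i)))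

/-- Before the last time without exit the clock is at most `a`, and the term at that time adds at
most another `a`: this overshoot is the reason for `2 * a`. -/
lemma sum_stay_le (hh : ∀ n ω, 0 ≤ h n ω) (hle : ∀ n ω, h n ω ≤ a) (ha : 0 ≤ a) (k : ℕ) (ω : Ω) :
    ∀ n, ∑ l ∈ Finset.Ico k n, (stay d h s a k l).indicator (h l) ω ≤ 2 * a := by
  intro n
  induction n with
  | zero => simp; linarith
  | succ n ih =>
    by_cases hkn : k ≤ n
    · by_cases hn : ω ∈ stay d h s a k n
      · have h1 : ∑ l ∈ Finset.Ico k n, (stay d h s a k l).indicator (h l) ω ≤ a := by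
          rcases hkn.eq_or_lt with rfl | hlt
          · simpa using ha
          · refine le_trans (Finset.sum_le_sum fun l _ => ?_) (hn n hlt le_rfl).2
            exact Set.indicator_le_self' (fun _ _ => hh l _) ω
        rw [Finset.sum_Ico_succ_top hkn, Set.indicator_of_mem hn]
        linarith [hle n ω]
      · rw [Finset.sum_Ico_succ_top hkn, Set.indicator_of_notMem hn, add_zero]
        exact ih
    · rw [Finset.Ico_eq_empty (by omega)]
      simp; linarith

/-- Chebyshev's inequality for the martingale stopped at its first exit. Its second moment is at
most `D² · 2a · μ B`, while `s² = 16 D² a`, whence the factor `8`. -/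
lemma IsClocked.measure_spaceExit_le {D : ℝ} (hE : IsTwoSmooth.{u, v} E D)
    (H : IsClocked μ 𝒢 a d h) (ha : 0 < a) (hs : s = 4 * D * Real.sqrt a) (N k : ℕ)
    {B : Set Ω} (hB : MeasurableSet[𝒢 k] B) :
    8 * μ (B ∩ ⋃ i ∈ Finset.Ico k N, spaceExit d h s a k i) ≤ μ B := by
  have hD := hE.one_le
  -- Whether the path, started at `k` on `B`, is still running at time `i` is known at time `i`, so
  -- cutting `d i` off outside `G i` preserves martingale differences.
  set G : ℕ → Set Ω := fun i => if k ≤ i then B ∩ stay d h s a k i else ∅ with hGdef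
  have hG : ∀ i, MeasurableSet[𝒢 i] (G i) := by
    intro i
    by_cases hi : k ≤ i
    · simp only [hGdef, hi, if_true]
      exact (𝒢.mono hi _ hB).inter (H.measurableSet_stay k i)
    · simp only [hGdef, hi, if_false]
      exact @MeasurableSet.empty _ (𝒢 i)
  have hG' : ∀ i, MeasurableSet (G i) := fun i => 𝒢.le i _ (hG i)
  set S : Set Ω := B ∩ ⋃ i ∈ Finset.Ico k N, spaceExit d h s a k i with hSdef
  have hBm : MeasurableSet B := 𝒢.le k _ hB
  have hSm : MeasurableSet S := hBm.inter
    (Finset.measurableSet_biUnion _ fun i _ => 𝒢.le _ _ (H.measurableSet_spaceExit k i))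
  have hmem : ∀ n, MemLp ((G n).indicator (d n)) 2 μ := fun n => (H.memLp n).indicator (hG' n)
  have key := hE.moment_le Ω μ 𝒢 (fun n => (G n).indicator (d n)) (H.diff.indicator hG) hmem N
  have hspos : 0 < s := by rw [hs]; positivity
  have hhint : ∀ n, Integrable (h n) μ := fun n =>
    Integrable.of_bound ((H.measurable n).mono (𝒢.le n) le_rfl).aestronglyMeasurable a
      (ae_of_all _ fun ω => by rw [Real.norm_of_nonneg (H.nonneg n ω)]; exact H.le n ω)
  have hpath : ∀ ω ∈ S, s < ‖∑ n ∈ Finset.range N, (G n).indicator (d n) ω‖ := by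
    rintro ω ⟨hωB, hω⟩
    simp only [Set.mem_iUnion, Finset.mem_Ico, exists_prop] at hω
    obtain ⟨i, ⟨hki, hiN⟩, hst, hsp⟩ := hω
    have : ∑ n ∈ Finset.range N, (G n).indicator (d n) ω = ∑ l ∈ Finset.Ico k (i + 1), d l ω := by
      rw [← Finset.sum_subset (s₁ := Finset.Ico k (i + 1)) (s₂ := Finset.range N)]
      · refine Finset.sum_congr rfl fun l hl => ?_
        obtain ⟨hl1, hl2⟩ := Finset.mem_Ico.1 hl
        rw [Set.indicator_of_mem]
        simp only [hGdef, hl1, if_true]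
        exact ⟨hωB, fun j hj hj' => hst j hj (by omega)⟩
      · intro l hl
        simp only [Finset.mem_Ico, Finset.mem_range] at hl ⊢
        omega
      · intro l _ hl
        rw [Set.indicator_of_notMem]
        simp only [hGdef]
        split_ifs with hkl
        · rintro ⟨-, h2⟩
          have h3 : i + 1 ≤ l := by
            simp only [Finset.mem_Ico, not_and, not_lt] at hl
            exact hl hkl
          exact absurd (h2 (i + 1) (by omega) h3).1 (not_le.2 hsp)
        · exact Set.notMem_empty _
    rw [this]
    exact hsp
  have h1 : s ^ 2 * μ.real S ≤ ∫ ω, ‖∑ n ∈ Finset.range N, (G n).indicator (d n) ω‖ ^ 2 ∂μ := by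
    have hint : Integrable (fun ω => ‖∑ n ∈ Finset.range N, (G n).indicator (d n) ω‖ ^ 2) μ :=
      (memLp_finsetSum _ fun n _ => hmem n).integrable_norm_pow (by norm_num)
    calc s ^ 2 * μ.real S = ∫ ω in S, s ^ 2 ∂μ := by simp [mul_comm]
      _ ≤ ∫ ω in S, ‖∑ n ∈ Finset.range N, (G n).indicator (d n) ω‖ ^ 2 ∂μ := by
          refine setIntegral_mono_on (by simp) hint.integrableOn hSm fun ω hω => ?_
          have := hpath ω hω
          gcongr
      _ ≤ _ := setIntegral_le_integral hint (ae_of_all _ fun ω => by positivity)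
  have h2 : ∀ n, ∫ ω, ‖(G n).indicator (d n) ω‖ ^ 2 ∂μ ≤ ∫ ω in G n, h n ω ∂μ := by
    intro n
    refine le_trans (le_of_eq ?_) (H.sq_le n _ (hG n))
    rw [← integral_indicator (hG' n)]
    congr 1
    ext ω
    by_cases hω : ω ∈ G n <;> simp [hω]
  have h3 : ∑ n ∈ Finset.range N, ∫ ω in G n, h n ω ∂μ ≤ 2 * a * μ.real B := by
    have e1 : ∀ n ∈ Finset.range N, ∫ ω in G n, h n ω ∂μ = ∫ ω, (G n).indicator (h n) ω ∂μ :=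
      fun n _ => (integral_indicator (hG' n)).symm
    rw [Finset.sum_congr rfl e1, ← integral_finsetSum _ fun n _ => (hhint n).indicator (hG' n)]
    have e2 : ∫ ω, B.indicator (fun _ => 2 * a) ω ∂μ = 2 * a * μ.real B := by
      rw [integral_indicator hBm]; simp [mul_comm]
    rw [← e2]
    refine integral_mono (integrable_finsetSum _ fun n _ => (hhint n).indicator (hG' n))
      ((integrable_const _).indicator hBm) fun ω => ?_
    by_cases hω : ω ∈ B
    · rw [Set.indicator_of_mem hω]
      refine le_trans (le_of_eq ?_) (sum_stay_le (d := d) (s := s) H.nonneg H.le ha.le k ω N)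
      rw [← Finset.sum_subset (s₁ := Finset.Ico k N) (s₂ := Finset.range N)
        (f := fun l => (G l).indicator (h l) ω)]
      · refine Finset.sum_congr rfl fun l hl => ?_
        have : G l = B ∩ stay d h s a k l := by simp [hGdef, (Finset.mem_Ico.1 hl).1]
        rw [this]
        by_cases hst : ω ∈ stay d h s a k l
        · rw [Set.indicator_of_mem hst, Set.indicator_of_mem (show ω ∈ B ∩ stay d h s a k l from ⟨hω, hst⟩)]
        · rw [Set.indicator_of_notMem hst, Set.indicator_of_notMem (fun hh => hst hh.2)]
      · intro l hl
        simp only [Finset.mem_Ico, Finset.mem_range] at hl ⊢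
        omega
      · intro l hl hl'
        have : ¬ k ≤ l := by
          simp only [Finset.mem_Ico, Finset.mem_range, not_and] at hl hl'
          tauto
        simp [hGdef, this]
    · rw [Set.indicator_of_notMem hω]
      refine le_of_eq (Finset.sum_eq_zero fun l _ => Set.indicator_of_notMem ?_ _)
      simp only [hGdef]
      split_ifs
      · exact fun hh => hω hh.1
      · exact Set.notMem_empty _
  have h4 : s ^ 2 * μ.real S ≤ D ^ 2 * (2 * a * μ.real B) :=
    h1.trans (key.trans (mul_le_mul_of_nonneg_left
      ((Finset.sum_le_sum fun n _ => h2 n).trans h3) (sq_nonneg D)))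
  have hs2 : s ^ 2 = 16 * D ^ 2 * a := by
    rw [hs, mul_pow, mul_pow, Real.sq_sqrt ha.le]; ring
  have h5 : 8 * μ.real S ≤ μ.real B := by
    have hpos : 0 < 2 * D ^ 2 * a := by positivity
    refine le_of_mul_le_mul_left ?_ hpos
    rw [hs2] at h4
    linarith
  rw [← ofReal_measureReal (s := S), ← ofReal_measureReal (s := B)]
  rw [show (8 : ℝ≥0∞) = ENNReal.ofReal 8 by simp, ← ENNReal.ofReal_mul (by norm_num)]
  exact ENNReal.ofReal_le_ofReal h5

/-- Supermartingale property of the weight, by induction on the number of counted exits: a space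
exit has conditional probability at most `1/8` and costs a factor `4`, a clock exit costs `1/2`, and
`4/8 + 1/2 = 1`. -/
lemma IsClocked.setLIntegral_weight_le {D : ℝ} (hE : IsTwoSmooth.{u, v} E D)
    (H : IsClocked μ 𝒢 a d h) (ha : 0 < a) (hs : s = 4 * D * Real.sqrt a) (N f : ℕ) :
    ∀ k, ∀ B : Set Ω, MeasurableSet[𝒢 k] B → ∫⁻ ω in B, weight d h s a N f k ω ∂μ ≤ μ B := by
  induction f with
  | zero => intro k B _; simp [weight]
  | succ f ih =>
    intro k B hB
    by_cases hk : N ≤ k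
    · simp [weight, hk]
    have hBm : MeasurableSet B := 𝒢.le k _ hB
    have hS := fun i => 𝒢.le _ _ (H.measurableSet_spaceExit (s := s) k i)
    have hC := fun i => 𝒢.le _ _ (H.measurableSet_clockExit (s := s) N k i)
    have hW := fun i => H.measurable_weight (s := s) N f (i + 1)
    simp only [weight, hk, if_false]
    rw [lintegral_finsetSum _ fun i _ => Measurable.fun_add (((hW i).const_mul 4).indicator (hS i))
        (((hW i).const_mul 2⁻¹).indicator (hC i))]
    have term : ∀ i ∈ Finset.Ico k N, ∫⁻ ω in B,
        ((spaceExit d h s a k i).indicator (fun ω => 4 * weight d h s a N f (i + 1) ω) ω +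
        (clockExit d h s a N k i).indicator (fun ω => 2⁻¹ * weight d h s a N f (i + 1) ω) ω) ∂μ
        ≤ 4 * μ (B ∩ spaceExit d h s a k i) + 2⁻¹ * μ (B ∩ clockExit d h s a N k i) := by
      intro i hi
      have hki : k ≤ i + 1 := by have := Finset.mem_Ico.1 hi; omega
      rw [lintegral_add_left (((hW i).const_mul 4).indicator (hS i)),
        setLIntegral_indicator (hS i), setLIntegral_indicator (hC i),
        lintegral_const_mul _ (hW i), lintegral_const_mul _ (hW i),
        Set.inter_comm _ B, Set.inter_comm _ B]
      gcongr
      · exact ih (i + 1) _ ((𝒢.mono hki _ hB).inter (H.measurableSet_spaceExit k i))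
      · exact ih (i + 1) _ ((𝒢.mono hki _ hB).inter (H.measurableSet_clockExit N k i))
    refine (Finset.sum_le_sum term).trans ?_
    rw [Finset.sum_add_distrib, ← Finset.mul_sum, ← Finset.mul_sum]
    -- An exit strictly before time `i + 1` contradicts `stay` up to `i`, so exits of the same kind
    -- at different times are disjoint events.
    have key : ∀ i j ω, ω ∈ stay d h s a k i → k ≤ j → j < i →
        ω ∈ spaceExit d h s a k j ∪ {ω | a < ∑ l ∈ Finset.Ico k (j + 1), h l ω} → False := by
      rintro i j ω hst hkj hji (hsp | hcl)
      · exact absurd (hst (j + 1) (by omega) (by omega)).1 (not_le.2 hsp.2)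
      · exact absurd (hst (j + 1) (by omega) (by omega)).2 (not_le.2 hcl)
    have hdisS : ∀ i ∈ Finset.Ico k N, ∀ j ∈ Finset.Ico k N, j < i →
        Disjoint (spaceExit d h s a k j) (spaceExit d h s a k i) := by
      intro i hi j hj hji
      rw [Set.disjoint_left]
      intro ω h1 h2
      exact key i j ω h2.1 (Finset.mem_Ico.1 hj).1 hji (Or.inl h1)
    have hdisC : ∀ i ∈ Finset.Ico k N, ∀ j ∈ Finset.Ico k N, j < i →
        Disjoint (clockExit d h s a N k j) (clockExit d h s a N k i) := by
      intro i hi j hj hji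
      rw [Set.disjoint_left]
      intro ω h1 h2
      rcases h1.2.2 with hcl | hN
      · exact key i j ω h2.1 (Finset.mem_Ico.1 hj).1 hji (Or.inr hcl)
      · have := Finset.mem_Ico.1 hi; omega
    have sumS : ∑ i ∈ Finset.Ico k N, μ (B ∩ spaceExit d h s a k i)
        = μ (B ∩ ⋃ i ∈ Finset.Ico k N, spaceExit d h s a k i) := by
      rw [Set.inter_iUnion₂, measure_biUnion_finset]
      · intro i hi j hj hij
        rcases lt_or_gt_of_ne hij with hlt | hlt
        · exact (hdisS j hj i hi hlt).mono Set.inter_subset_right Set.inter_subset_right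
        · exact (hdisS i hi j hj hlt).symm.mono Set.inter_subset_right Set.inter_subset_right
      · exact fun i _ => hBm.inter (hS i)
    have sumC : ∑ i ∈ Finset.Ico k N, μ (B ∩ clockExit d h s a N k i) ≤ μ B := by
      rw [← measure_biUnion_finset]
      · exact measure_mono (Set.iUnion₂_subset fun i _ => Set.inter_subset_left)
      · intro i hi j hj hij
        rcases lt_or_gt_of_ne hij with hlt | hlt
        · exact (hdisC j hj i hi hlt).mono Set.inter_subset_right Set.inter_subset_right
        · exact (hdisC i hi j hj hlt).symm.mono Set.inter_subset_right Set.inter_subset_right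
      · exact fun i _ => hBm.inter (hC i)
    rw [sumS]
    have hmain := H.measure_spaceExit_le hE ha hs N k hB
    calc 4 * μ (B ∩ ⋃ i ∈ Finset.Ico k N, spaceExit d h s a k i) +
          2⁻¹ * ∑ i ∈ Finset.Ico k N, μ (B ∩ clockExit d h s a N k i)
        = 2⁻¹ * (8 * μ (B ∩ ⋃ i ∈ Finset.Ico k N, spaceExit d h s a k i)) +
          2⁻¹ * ∑ i ∈ Finset.Ico k N, μ (B ∩ clockExit d h s a N k i) := by
          rw [← mul_assoc, show (2⁻¹ : ℝ≥0∞) * 8 = 4 by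
            rw [show (8 : ℝ≥0∞) = 2 * 4 by norm_num, ← mul_assoc,
              ENNReal.inv_mul_cancel (by norm_num) (by norm_num), one_mul]]
      _ ≤ 2⁻¹ * μ B + 2⁻¹ * μ B := by gcongr
      _ = μ B := by rw [← add_mul, ENNReal.inv_two_add_inv_two, one_mul]

/-- Pathwise half of the argument: the path is followed from exit to exit. Each exit moves it by at
most `s + √a`, larger jumps being charged to the last sum. A clock exit uses more than `a` of the
clock, except the one forced by the horizon, which the extra `a` pays for. Exits are counted up to
`N` whatever `n` is, so the later bound is uniform in `n ≤ N`. As every exit advances time, `N ≤ f +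
k` ensures that all exits are counted. -/
lemma exists_exits_le_weight (hh : ∀ n ω, 0 ≤ h n ω) (ha : 0 < a) (hs : 0 ≤ s) (N : ℕ) (ω : Ω)
    (n : ℕ) (hn : n ≤ N) (f : ℕ) : ∀ k, N ≤ f + k → ∃ ns nc : ℕ,
      (4 : ℝ≥0∞) ^ ns * 2⁻¹ ^ nc ≤ weight d h s a N f k ω ∧
      a * nc ≤ ∑ l ∈ Finset.Ico k N, h l ω + (if N ≤ k then 0 else a) ∧
      ‖∑ l ∈ Finset.Ico k n, d l ω‖ ≤ (s + Real.sqrt a) * (ns + nc + 1) +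
        ∑ l ∈ Finset.Ico k n, {ω | Real.sqrt a < ‖d l ω‖}.indicator (fun ω => ‖d l ω‖) ω := by
  have hsa : 0 < s + Real.sqrt a := by positivity
  have hbig : ∀ k n : ℕ, 0 ≤ ∑ l ∈ Finset.Ico k n,
      {ω | Real.sqrt a < ‖d l ω‖}.indicator (fun ω => ‖d l ω‖) ω := fun k n =>
    Finset.sum_nonneg fun l _ => Set.indicator_nonneg (fun _ _ => norm_nonneg _) _
  have hclk : ∀ k n : ℕ, 0 ≤ ∑ l ∈ Finset.Ico k n, h l ω := fun k n =>
    Finset.sum_nonneg fun l _ => hh l ω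
  have hlast : ∀ f k : ℕ, N ≤ k → ∃ ns nc : ℕ,
      (4 : ℝ≥0∞) ^ ns * 2⁻¹ ^ nc ≤ weight d h s a N f k ω ∧
      a * nc ≤ ∑ l ∈ Finset.Ico k N, h l ω + (if N ≤ k then 0 else a) ∧
      ‖∑ l ∈ Finset.Ico k n, d l ω‖ ≤ (s + Real.sqrt a) * (ns + nc + 1) +
        ∑ l ∈ Finset.Ico k n, {ω | Real.sqrt a < ‖d l ω‖}.indicator (fun ω => ‖d l ω‖) ω := by
    intro f k hk
    refine ⟨0, 0, ?_, ?_, ?_⟩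
    · cases f <;> simp [weight, hk]
    · simp [hk]
    · rw [Finset.Ico_eq_empty_of_le (hn.trans hk)]
      simpa using hsa.le
  induction f with
  | zero => exact fun k hN => hlast 0 k (by omega)
  | succ f ih =>
    intro k hN
    by_cases hk : N ≤ k
    · exact hlast _ k hk
    push Not at hk
    classical
    -- The witness `N - 1` is the exit forced by the horizon.
    have hex : ∃ i, k ≤ i ∧ (ω ∉ calm d h s a k (i + 1) ∨ i + 1 = N) := ⟨N - 1, by omega, by omega⟩
    set i := Nat.find hex with hi
    obtain ⟨hki, hexit⟩ := Nat.find_spec hex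
    rw [← hi] at hki hexit
    have hiN : i < N := by
      have : i ≤ N - 1 := Nat.find_min' hex ⟨by omega, by omega⟩
      omega
    have hst : ω ∈ stay d h s a k i := by
      intro j hj hji
      have := Nat.find_min hex (m := j - 1) (by omega)
      push Not at this
      have := (this (by omega)).1
      rwa [show j - 1 + 1 = j by omega] at this
    have hstay_le : ∀ j, j ≤ i → ‖∑ l ∈ Finset.Ico k j, d l ω‖ ≤ s := by
      intro j hji
      rcases le_or_gt j k with hj | hlt
      · rw [Finset.Ico_eq_empty_of_le hj]
        simpa using hs
      · exact (hst j hlt hji).1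
    have hjump : ‖∑ l ∈ Finset.Ico k (i + 1), d l ω‖ ≤ (s + Real.sqrt a) +
        ∑ l ∈ Finset.Ico k (i + 1), {ω | Real.sqrt a < ‖d l ω‖}.indicator (fun ω => ‖d l ω‖) ω := by
      rw [Finset.sum_Ico_succ_top hki, Finset.sum_Ico_succ_top hki]
      have h1 := hstay_le i le_rfl
      have h2 : ‖d i ω‖ ≤ Real.sqrt a +
          {ω | Real.sqrt a < ‖d i ω‖}.indicator (fun ω => ‖d i ω‖) ω := by
        by_cases hb : Real.sqrt a < ‖d i ω‖
        · rw [Set.indicator_of_mem (by exact hb)]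
          linarith [Real.sqrt_nonneg a]
        · rw [Set.indicator_of_notMem (by exact hb)]
          linarith
      linarith [norm_add_le (∑ l ∈ Finset.Ico k i, d l ω) (d i ω), hbig k i]
    obtain ⟨ns, nc, hw, hc, hm⟩ := ih (i + 1) (by omega)
    -- The `2` stands for the exit at `i + 1` and for the incomplete stretch after the last exit.
    have hm' : ‖∑ l ∈ Finset.Ico k n, d l ω‖ ≤ (s + Real.sqrt a) * (ns + nc + 2) +
        ∑ l ∈ Finset.Ico k n, {ω | Real.sqrt a < ‖d l ω‖}.indicator (fun ω => ‖d l ω‖) ω := by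
      have hnn : (0 : ℝ) ≤ (s + Real.sqrt a) * (ns + nc) := by positivity
      rcases le_or_gt n i with hni | hni
      · have h1 := hstay_le n hni
        have h2 := hbig k n
        nlinarith [Real.sqrt_nonneg a]
      · rw [← Finset.sum_Ico_consecutive _ (by omega : k ≤ i + 1) (by omega : i + 1 ≤ n),
          ← Finset.sum_Ico_consecutive _ (by omega : k ≤ i + 1) (by omega : i + 1 ≤ n)]
        have h1 := norm_add_le (∑ l ∈ Finset.Ico k (i + 1), d l ω)
          (∑ l ∈ Finset.Ico (i + 1) n, d l ω)
        linarith
    have hsplit := Finset.sum_Ico_consecutive (fun l => h l ω) (by omega : k ≤ i + 1)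
      (by omega : i + 1 ≤ N)
    have hWle : (spaceExit d h s a k i).indicator
          (fun ω => 4 * weight d h s a N f (i + 1) ω) ω +
        (clockExit d h s a N k i).indicator (fun ω => 2⁻¹ * weight d h s a N f (i + 1) ω) ω ≤
        weight d h s a N (f + 1) k ω := by
      simp only [weight, not_le.2 hk, if_false]
      exact Finset.single_le_sum (f := fun i =>
        (spaceExit d h s a k i).indicator (fun ω => 4 * weight d h s a N f (i + 1) ω) ω +
        (clockExit d h s a N k i).indicator (fun ω => 2⁻¹ * weight d h s a N f (i + 1) ω) ω)
        (fun _ _ => zero_le) (Finset.mem_Ico.2 ⟨hki, hiN⟩)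
    have hk' : ¬ N ≤ k := not_le.2 hk
    by_cases hsp : s < ‖∑ l ∈ Finset.Ico k (i + 1), d l ω‖
    · refine ⟨ns + 1, nc, le_trans ?_ hWle, ?_, ?_⟩
      · rw [Set.indicator_of_mem (show ω ∈ spaceExit d h s a k i from ⟨hst, hsp⟩)]
        refine le_trans ?_ le_self_add
        rw [pow_succ', mul_assoc]
        gcongr
      · rw [if_neg hk']
        have := hclk k (i + 1)
        split_ifs at hc <;> linarith
      · push_cast
        linarith
    · have hcl : a < ∑ l ∈ Finset.Ico k (i + 1), h l ω ∨ i + 1 = N := by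
        rcases hexit with hx | hx
        · left
          by_contra hcon
          exact hx ⟨not_lt.1 hsp, not_lt.1 hcon⟩
        · exact Or.inr hx
      refine ⟨ns, nc + 1, le_trans ?_ hWle, ?_, ?_⟩
      · rw [Set.indicator_of_mem (show ω ∈ clockExit d h s a N k i from ⟨hst, hsp, hcl⟩)]
        refine le_trans ?_ le_add_self
        rw [pow_succ', mul_left_comm]
        gcongr
      · rw [if_neg hk']
        push_cast
        rcases hcl with hx | hx
        · split_ifs at hc <;> linarith
        · rw [if_pos hx.ge, hx, Finset.Ico_self, Finset.sum_empty] at hc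
          have := hclk k N
          linarith
      · push_cast
        linarith

/-- Maximal tail bound, up to the horizon `N`, on the event that the clock is at most `K a`. -/
theorem IsClocked.measure_lt_norm_sum_le {D : ℝ} (hE : IsTwoSmooth.{u, v} E D)
    (H : IsClocked μ 𝒢 a d h) (ha : 0 < a) (N K : ℕ) (hK : 1 ≤ K) :
    μ {ω | ∑ l ∈ Finset.range N, h l ω ≤ K * a ∧ ∃ n ≤ N,
      20 * D * Real.sqrt a * K + ∑ l ∈ Finset.range n,
        {ω | Real.sqrt a < ‖d l ω‖}.indicator (fun ω => ‖d l ω‖) ω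
        < ‖∑ l ∈ Finset.range n, d l ω‖} ≤ 2 * 2⁻¹ ^ (3 * K) := by
  have hD := hE.one_le
  set s := 4 * D * Real.sqrt a with hs
  have hs0 : 0 ≤ s := by positivity
  have hW := H.setLIntegral_weight_le hE ha hs N N 0 Set.univ (@MeasurableSet.univ _ (𝒢 0))
  rw [Measure.restrict_univ, measure_univ] at hW
  have hpow : ∀ m n : ℕ, (2 : ℝ≥0∞) ^ m * 2⁻¹ ^ n * 2 ^ n = 2 ^ m := by
    intro m n
    rw [mul_assoc, ← mul_pow, ENNReal.inv_mul_cancel (by norm_num) (by norm_num), one_pow, mul_one]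
  have hsub : {ω | ∑ l ∈ Finset.range N, h l ω ≤ K * a ∧ ∃ n ≤ N,
      20 * D * Real.sqrt a * K + ∑ l ∈ Finset.range n,
        {ω | Real.sqrt a < ‖d l ω‖}.indicator (fun ω => ‖d l ω‖) ω
        < ‖∑ l ∈ Finset.range n, d l ω‖} ⊆ {ω | 2 ^ (3 * K - 1) ≤ weight d h s a N N 0 ω} := by
    rintro ω ⟨hclk, n, hn, hbig⟩
    obtain ⟨ns, nc, hw, hc, hm⟩ := exists_exits_le_weight (d := d) H.nonneg ha hs0 N ω n hn N 0 le_rfl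
    simp only [← Finset.range_eq_Ico] at hc hm
    have hnc : nc ≤ K + 1 := by
      have h1 : a * nc ≤ a * (K + 1) := by split_ifs at hc <;> linarith
      exact_mod_cast le_of_mul_le_mul_left h1 ha
    -- Since `s + √a ≤ 5 D √a`, the threshold `20 D √a K` allows for `4 K` such moves.
    have hexit : 3 * K < ns + nc := by
      have h1 : 20 * D * Real.sqrt a * K < (s + Real.sqrt a) * (ns + nc + 1) := by linarith
      have hsq : 0 < Real.sqrt a := Real.sqrt_pos.2 ha
      have h2 : (s + Real.sqrt a) * (ns + nc + 1) ≤ (5 * D * Real.sqrt a) * (ns + nc + 1) := by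
        rw [hs]; gcongr; nlinarith
      have h3 : (5 * D * Real.sqrt a) * (4 * K) < (5 * D * Real.sqrt a) * (ns + nc + 1) := by
        linarith
      have h4 := lt_of_mul_lt_mul_left h3 (by positivity)
      have h5 : 4 * K < ns + nc + 1 := by exact_mod_cast h4
      omega
    refine le_trans ?_ hw
    rw [show (4 : ℝ≥0∞) = 2 ^ 2 by norm_num, ← pow_mul]
    have h2 : (2 : ℝ≥0∞) ^ nc ≠ 0 := by positivity
    have h3 : (2 : ℝ≥0∞) ^ nc ≠ ∞ := by finiteness
    rw [← ENNReal.mul_le_mul_iff_left h2 h3, hpow, ← pow_add]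
    -- From `2 (ns + nc) ≥ 6 K + 2` and `3 nc ≤ 3 K + 3` follows `2 ns - nc ≥ 3 K - 1`.
    exact pow_le_pow_right₀ (by norm_num) (by omega)
  have hmark := mul_meas_ge_le_lintegral (μ := μ) (H.measurable_weight (s := s) N N 0)
    (2 ^ (3 * K - 1))
  refine (measure_mono hsub).trans ?_
  have h2 : (2 : ℝ≥0∞) ^ (3 * K - 1) ≠ 0 := by positivity
  have h3 : (2 : ℝ≥0∞) ^ (3 * K - 1) ≠ ∞ := by finiteness
  rw [← ENNReal.mul_le_mul_iff_right h2 h3]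
  refine (hmark.trans hW).trans (le_of_eq ?_)
  have := hpow 0 (3 * K)
  rw [pow_zero, one_mul] at this
  rw [← mul_assoc, ← pow_succ, show 3 * K - 1 + 1 = 3 * K by omega, mul_comm, this]

end Concentration

end HannanLIL

end

noncomputable section

namespace HannanLIL

/-! ### The maximal ergodic theorem -/

section MaximalErgodic

variable {Ω : Type u} [mΩ : MeasurableSpace Ω] {μ : Measure Ω} {T : Ω → Ω}

/-- The maximum of the Birkhoff sums of `f` of lengths `0, …, N`. -/
def maxBirkhoff (T : Ω → Ω) (f : Ω → ℝ) : ℕ → Ω → ℝ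
  | 0, _ => 0
  | N + 1, ω => max 0 (f ω + maxBirkhoff T f N (T ω))

lemma maxBirkhoff_nonneg (f : Ω → ℝ) (N : ℕ) (ω : Ω) : 0 ≤ maxBirkhoff T f N ω := by
  cases N <;> simp [maxBirkhoff]

lemma maxBirkhoff_le_succ (f : Ω → ℝ) (N : ℕ) :
    ∀ ω, maxBirkhoff T f N ω ≤ maxBirkhoff T f (N + 1) ω := by
  induction N with
  | zero => intro ω; simp [maxBirkhoff]
  | succ N ih =>
    intro ω
    rw [maxBirkhoff, maxBirkhoff]
    gcongr
    exact ih _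

lemma birkhoffSum_le_maxBirkhoff (f : Ω → ℝ) (N : ℕ) :
    ∀ n ≤ N, ∀ ω, birkhoffSum T f n ω ≤ maxBirkhoff T f N ω := by
  induction N with
  | zero =>
    intro n hn ω
    obtain rfl : n = 0 := by omega
    simp [maxBirkhoff]
  | succ N ih =>
    intro n hn ω
    cases n with
    | zero => simpa using maxBirkhoff_nonneg f _ ω
    | succ n =>
      rw [birkhoffSum_succ', maxBirkhoff]
      exact le_max_of_le_right (by gcongr; exact ih n (by omega) _)

lemma measurable_maxBirkhoff (hT : Measurable T) {f : Ω → ℝ} (hf : Measurable f) (N : ℕ) :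
    Measurable (maxBirkhoff T f N) := by
  induction N with
  | zero => exact measurable_const
  | succ N ih => exact measurable_const.max (hf.add (ih.comp hT))

lemma integrable_maxBirkhoff (hT : MeasurePreserving T μ μ) {f : Ω → ℝ} (hf : Integrable f μ)
    (N : ℕ) : Integrable (maxBirkhoff T f N) μ := by
  induction N with
  | zero => exact integrable_zero _ _ _
  | succ N ih => exact (integrable_zero Ω ℝ μ).sup (hf.add (hT.integrable_comp_of_integrable ih))

/-- The maximal ergodic theorem. -/
lemma setIntegral_maxBirkhoff_pos_nonneg (hT : MeasurePreserving T μ μ) {f : Ω → ℝ}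
    (hfm : Measurable f) (hf : Integrable f μ) (N : ℕ) :
    0 ≤ ∫ ω in {ω | 0 < maxBirkhoff T f N ω}, f ω ∂μ := by
  set m := maxBirkhoff T f N with hm
  have hint : Integrable m μ := integrable_maxBirkhoff hT hf N
  have hmeas : Measurable m := measurable_maxBirkhoff hT.measurable hfm N
  have hcomp : Integrable (m ∘ T) μ := hT.integrable_comp_of_integrable hint
  have hset : MeasurableSet {ω | 0 < m ω} := measurableSet_lt measurable_const hmeas
  have h0 : ∫ ω, (m ω - m (T ω)) ∂μ = 0 := by
    rw [show ∫ ω, (m ω - m (T ω)) ∂μ = ∫ ω, m ω ∂μ - ∫ ω, m (T ω) ∂μ from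
      integral_sub hint hcomp]
    have : ∫ ω, m (T ω) ∂μ = ∫ ω, m ω ∂μ := by
      conv_rhs => rw [← hT.map_eq]
      rw [integral_map hT.measurable.aemeasurable hmeas.aestronglyMeasurable]
    rw [this, sub_self]
  rw [← integral_indicator hset]
  -- Pointwise `m - m ∘ T ≤ f` on `{m > 0}`, by the recursion and monotonicity in `N`; elsewhere `m
  -- = 0` and the left side is at most `0`. The integral of `m - m ∘ T` vanishes by invariance.
  refine h0.ge.trans (integral_mono (hint.sub hcomp) (hf.indicator hset) fun ω => ?_)
  by_cases hω : 0 < m ω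
  · rw [Set.indicator_of_mem (by exact hω)]
    cases N with
    | zero => simp [hm, maxBirkhoff] at hω
    | succ N =>
      have h1 : m ω = f ω + maxBirkhoff T f N (T ω) := by
        have h2 : m ω = max 0 (f ω + maxBirkhoff T f N (T ω)) := rfl
        rcases max_choice 0 (f ω + maxBirkhoff T f N (T ω)) with h3 | h3
        · rw [h2, h3] at hω; exact absurd hω (lt_irrefl 0)
        · rw [h2, h3]
      have h2 := maxBirkhoff_le_succ (T := T) f N (T ω)
      simp only [← hm] at h2
      linarith
  · rw [Set.indicator_of_notMem (by exact hω)]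
    have h1 : 0 ≤ m (T ω) := maxBirkhoff_nonneg f N _
    linarith

/-- The weak type `(1, 1)` maximal inequality for ergodic averages. -/
lemma measure_lt_birkhoffSum_le [IsProbabilityMeasure μ] (hT : MeasurePreserving T μ μ)
    {h : Ω → ℝ} (hm : Measurable h) (hi : Integrable h μ) (h0 : 0 ≤ h) {v : ℝ} (hv : 0 < v) :
    μ {ω | ∃ n : ℕ, n * v < birkhoffSum T h n ω} ≤ ENNReal.ofReal ((∫ ω, h ω ∂μ) / v) := by
  -- The maximal theorem is applied to `h - v`, whose sums are positive exactly where the average of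
  -- `h` exceeds `v`.
  have hbound : ∀ N : ℕ, μ {ω | 0 < maxBirkhoff T (fun ω => h ω - v) N ω}
      ≤ ENNReal.ofReal ((∫ ω, h ω ∂μ) / v) := by
    intro N
    have hset : MeasurableSet {ω | 0 < maxBirkhoff T (fun ω => h ω - v) N ω} :=
      measurableSet_lt measurable_const
        (measurable_maxBirkhoff hT.measurable (hm.sub_const v) N)
    have h1 := setIntegral_maxBirkhoff_pos_nonneg hT (hm.sub_const v)
      (hi.sub (integrable_const v)) N
    rw [integral_sub hi.integrableOn (integrable_const v).integrableOn] at h1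
    have h2 := setIntegral_le_integral (s := {ω | 0 < maxBirkhoff T (fun ω => h ω - v) N ω})
      hi (ae_of_all _ h0)
    simp only [integral_const, MeasurableSet.univ, measureReal_restrict_apply, Set.univ_inter,
      smul_eq_mul] at h1
    rw [← ofReal_measureReal]
    refine ENNReal.ofReal_le_ofReal ?_
    rw [le_div_iff₀ hv]
    linarith
  have hsub : {ω | ∃ n : ℕ, n * v < birkhoffSum T h n ω} ⊆
      ⋃ N : ℕ, {ω | 0 < maxBirkhoff T (fun ω => h ω - v) N ω} := by
    rintro ω ⟨n, hn⟩
    refine Set.mem_iUnion.2 ⟨n, ?_⟩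
    refine lt_of_lt_of_le ?_ (birkhoffSum_le_maxBirkhoff _ n n le_rfl ω)
    have : birkhoffSum T (fun ω => h ω - v) n ω = birkhoffSum T h n ω - n * v := by
      simp [birkhoffSum, Finset.sum_sub_distrib]
    rw [this]
    linarith
  refine (measure_mono hsub).trans ?_
  rw [Monotone.measure_iUnion]
  · exact iSup_le hbound
  · refine monotone_nat_of_le_succ fun N ω hω => ?_
    exact lt_of_lt_of_le hω (maxBirkhoff_le_succ _ N ω)

end MaximalErgodic

/-! ### Dyadic scales and the iterated logarithm -/

section Levels

/-- The number of doubly logarithmic levels at the scale `2 ^ j`. -/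
def level (j : ℕ) : ℕ := Nat.log 2 (j + 1) + 2

lemma two_le_level (j : ℕ) : 2 ≤ level j := by simp [level]

lemma level_pos (j : ℕ) : (0 : ℝ) < level j := by
  have := two_le_level j
  exact_mod_cast (by omega : 0 < level j)

lemma level_succ_le (j : ℕ) : level (j + 1) ≤ level j + 1 := by
  have h1 : Nat.log 2 (j + 1 + 1) ≤ Nat.log 2 ((j + 1) * 2) := Nat.log_mono_right (by omega)
  rw [Nat.log_mul_base (by norm_num) (by omega)] at h1
  simp only [level]
  omega

lemma lt_two_pow_level (j : ℕ) : j + 1 < 2 ^ level j := by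
  have h1 : j + 1 < 2 ^ (Nat.log 2 (j + 1) + 1) := Nat.lt_pow_succ_log_self (by norm_num) _
  exact h1.trans (Nat.pow_lt_pow_right (by norm_num) (by simp [level]))

/-- The truncation profile `√(2 ^ j / level j)`. -/
def profile (j : ℕ) : ℝ := Real.sqrt (2 ^ j / level j)

lemma profile_pos (j : ℕ) : 0 < profile j :=
  Real.sqrt_pos.2 (div_pos (by positivity) (level_pos j))

/-- Levels are at least `2` and increase by at most `1`, so their ratio is at most `3/2`, and `64 ·
3/2 = 96 ≤ 98 = 49 · 2`. -/
lemma eight_mul_profile_le (j : ℕ) : 8 * profile j ≤ 7 * profile (j + 1) := by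
  have h1 : (level (j + 1) : ℝ) ≤ level j + 1 := by exact_mod_cast level_succ_le j
  have h2 : (2 : ℝ) ≤ level j := by exact_mod_cast two_le_level j
  have e8 : (8 : ℝ) = Real.sqrt 64 := by
    rw [show (64 : ℝ) = 8 ^ 2 by norm_num, Real.sqrt_sq (by norm_num)]
  have e7 : (7 : ℝ) = Real.sqrt 49 := by
    rw [show (49 : ℝ) = 7 ^ 2 by norm_num, Real.sqrt_sq (by norm_num)]
  rw [e8, e7, profile, profile, ← Real.sqrt_mul (by norm_num), ← Real.sqrt_mul (by norm_num)]
  refine Real.sqrt_le_sqrt ?_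
  rw [← mul_div_assoc, ← mul_div_assoc, div_le_div_iff₀ (level_pos _) (level_pos _), pow_succ]
  nlinarith [pow_pos (show (0 : ℝ) < 2 by norm_num) j]

lemma sum_profile_le (n : ℕ) : ∑ j ∈ Finset.range n, profile j ≤ 7 * profile n := by
  induction n with
  | zero => simpa using (profile_pos 0).le
  | succ n ih =>
    rw [Finset.sum_range_succ]
    linarith [eight_mul_profile_le n]

/-- By geometric growth with ratio at least `8/7`, the terms preceding the last profile below `x`
add up to at most `7` times that profile. -/
lemma sum_profile_lt_le {x : ℝ} (hx : 0 ≤ x) (n : ℕ) :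
    ∑ j ∈ Finset.range n, (if profile j < x then profile j else 0) ≤ 8 * x := by
  induction n with
  | zero => simpa using hx
  | succ n ih =>
    by_cases hn : profile n < x
    · have h1 : ∑ j ∈ Finset.range (n + 1), (if profile j < x then profile j else 0)
          ≤ ∑ j ∈ Finset.range (n + 1), profile j := by
        refine Finset.sum_le_sum fun j _ => ?_
        split_ifs
        · exact le_rfl
        · exact (profile_pos j).le
      rw [Finset.sum_range_succ profile] at h1
      linarith [sum_profile_le n]
    · rw [Finset.sum_range_succ, if_neg hn, add_zero]
      exact ih

lemma tsum_profile_lt_le {x : ℝ} (hx : 0 ≤ x) :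
    ∑' j, ENNReal.ofReal (if profile j < x then profile j else 0) ≤ ENNReal.ofReal (8 * x) := by
  refine ENNReal.tsum_le_of_sum_range_le fun n => ?_
  rw [← ENNReal.ofReal_sum_of_nonneg]
  · exact ENNReal.ofReal_le_ofReal (sum_profile_lt_le hx n)
  · intro j _
    split_ifs
    · exact (profile_pos j).le
    · exact le_rfl

lemma one_le_L (x : ℝ) : 1 ≤ L x := le_max_right _ _

lemma lilRate_pos {n : ℕ} (hn : 1 ≤ n) : 0 < lilRate n := by
  have h1 := one_le_L (L n)
  have h2 : (1 : ℝ) ≤ n := by exact_mod_cast hn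
  exact Real.sqrt_pos.2 (by positivity)

lemma two_pow_clog_le {n : ℕ} (hn : 1 ≤ n) : (2 : ℝ) ^ Nat.clog 2 n ≤ 2 * n := by
  rcases hn.eq_or_lt with rfl | hn2
  · simp
  · have h1 : 2 ^ (Nat.clog 2 n - 1) < n := Nat.pow_pred_clog_lt_self (by norm_num) hn2
    have h0 : 0 < Nat.clog 2 n := Nat.clog_pos (by norm_num) hn2
    have h2 : 2 ^ Nat.clog 2 n ≤ 2 * n := by
      have : 2 ^ Nat.clog 2 n = 2 * 2 ^ (Nat.clog 2 n - 1) := by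
        rw [← pow_succ']; congr 1; omega
      omega
    exact_mod_cast h2

lemma level_clog_le (n : ℕ) (hn : 1 ≤ n) : (level (Nat.clog 2 n) : ℝ) ≤ 6 * L (L n) := by
  set j := Nat.clog 2 n with hj
  have hl2 : 0.6931471803 < Real.log 2 := Real.log_two_gt_d9
  have hl2' : Real.log 2 < 0.6931471808 := Real.log_two_lt_d9
  have hlt : (2 : ℝ) ^ j ≤ 2 * n := two_pow_clog_le hn
  have hn0 : (0 : ℝ) < n := by exact_mod_cast hn
  have hlogn : (j : ℝ) * Real.log 2 ≤ Real.log 2 + Real.log n := by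
    rw [← Real.log_pow, ← Real.log_mul (by norm_num) hn0.ne']
    exact Real.log_le_log (by positivity) hlt
  -- For `j ≤ 4` the bound `L ≥ 1` suffices; beyond that `log n ≥ (j - 1) log 2` exceeds `(j + 1) /
  -- 5`.
  have hLn : ((j : ℝ) + 1) / 5 ≤ L n := by
    rcases le_or_gt j 4 with h4 | h4
    · have : (j : ℝ) ≤ 4 := by exact_mod_cast h4
      linarith [one_le_L (n : ℝ)]
    · have h5 : (5 : ℝ) ≤ j := by exact_mod_cast h4
      refine le_trans ?_ (le_max_left _ _)
      nlinarith
  have hj1 : (0 : ℝ) < (j : ℝ) + 1 := by positivity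
  have hlog : Real.log (j + 1) ≤ Real.log (L n) + Real.log 5 := by
    rw [← Real.log_mul (by linarith [one_le_L (n : ℝ)]) (by norm_num)]
    exact Real.log_le_log hj1 (by linarith)
  -- That is `125 ≤ 128`. Hence the level is at most `L (L n) / log 2 + 7/3 + 2`, which is below `6
  -- L (L n)` because `L (L n) ≥ 1`.
  have hlog5 : 3 * Real.log 5 ≤ 7 * Real.log 2 := by
    have h1 : Real.log (5 ^ 3) ≤ Real.log (2 ^ 7) :=
      Real.log_le_log (by norm_num) (by norm_num)
    rw [Real.log_pow, Real.log_pow] at h1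
    exact_mod_cast h1
  have hnat : (Nat.log 2 (j + 1) : ℝ) * Real.log 2 ≤ Real.log (j + 1) := by
    rw [← Real.log_pow]
    refine Real.log_le_log (by positivity) ?_
    exact_mod_cast Nat.pow_log_le_self 2 (by omega : j + 1 ≠ 0)
  have hx1 := one_le_L (L n)
  have hx2 : Real.log (L n) ≤ L (L n) := le_max_left _ _
  have hlev : (level j : ℝ) = Nat.log 2 (j + 1) + 2 := by simp [level]
  rw [hlev]
  by_contra hcon
  push Not at hcon
  nlinarith

/-- The normalisation `√(2 ^ j * level j)` at the scale `2 ^ j`. -/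
def rate (j : ℕ) : ℝ := Real.sqrt (2 ^ j * level j)

lemma rate_pos (j : ℕ) : 0 < rate j :=
  Real.sqrt_pos.2 (mul_pos (by positivity) (level_pos j))

lemma rate_clog_le {n : ℕ} (hn : 1 ≤ n) : rate (Nat.clog 2 n) ≤ 4 * lilRate n := by
  have h1 := level_clog_le n hn
  have h2 : (2 : ℝ) ^ Nat.clog 2 n ≤ 2 * n := two_pow_clog_le hn
  have h3 := one_le_L (L n)
  have e4 : (4 : ℝ) = Real.sqrt 16 := by
    rw [show (16 : ℝ) = 4 ^ 2 by norm_num, Real.sqrt_sq (by norm_num)]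
  rw [rate, lilRate, e4, ← Real.sqrt_mul (by norm_num)]
  refine Real.sqrt_le_sqrt ?_
  calc (2 : ℝ) ^ Nat.clog 2 n * level (Nat.clog 2 n) ≤ (2 * n) * (6 * L (L n)) := by gcongr
    _ ≤ 16 * (n * L (L n)) := by
      have : (0 : ℝ) ≤ n * L (L n) := by positivity
      linarith

lemma two_pow_div_rate (j : ℕ) : 2 ^ j / rate j = profile j := by
  have h1 := level_pos j
  have h2 : (0 : ℝ) < 2 ^ j := by positivity
  rw [div_eq_iff (rate_pos j).ne', profile, rate, ← Real.sqrt_mul (by positivity)]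
  rw [show (2 : ℝ) ^ j / level j * (2 ^ j * level j) = (2 ^ j) ^ 2 by field_simp,
    Real.sqrt_sq h2.le]

lemma level_mul_profile (j : ℕ) : level j * profile j = rate j := by
  have h1 := level_pos j
  have h2 : (0 : ℝ) < 2 ^ j := by positivity
  rw [profile, rate, ← Real.sqrt_sq h1.le, ← Real.sqrt_mul (by positivity)]
  congr 1
  rw [Real.sqrt_sq h1.le]
  field_simp

end Levels

end HannanLIL

end

noncomputable section

namespace HannanLIL

/-! ### Stationary sequences as clocked martingales -/

section Stationary

variable {Ω : Type u} {E : Type v} [NormedAddCommGroup E] [NormedSpace ℝ E] [CompleteSpace E]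

lemma setIntegral_preimage_comp {mΩ : MeasurableSpace Ω} {μ : Measure Ω} {T : Ω → Ω}
    (hT : MeasurePreserving T μ μ) {f : Ω → E}
    (hf : AEStronglyMeasurable f μ) {s : Set Ω} (hs : MeasurableSet s) :
    ∫ ω in T ⁻¹' s, f (T ω) ∂μ = ∫ ω in s, f ω ∂μ := by
  have h : μ.restrict s = (μ.restrict (T ⁻¹' s)).map T := by
    rw [← Measure.restrict_map hT.measurable hs, hT.map_eq]
  rw [h, integral_map hT.measurable.aemeasurable]
  rw [← h]
  exact hf.restrict

/-- Conditional expectations commute with measure preserving maps. -/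
lemma condExp_comp_comap {m mΩ : MeasurableSpace Ω} {μ : Measure Ω} [IsFiniteMeasure μ]
    {T : Ω → Ω} (hT : MeasurePreserving T μ μ) (hm : m ≤ mΩ) {f : Ω → E} (hf : Integrable f μ) :
    μ[f ∘ T | m.comap T] =ᵐ[μ] μ[f | m] ∘ T := by
  have hm' : m.comap T ≤ mΩ := (MeasurableSpace.comap_mono hm).trans hT.measurable.comap_le
  refine (ae_eq_condExp_of_forall_setIntegral_eq hm' (hT.integrable_comp_of_integrable hf) ?_ ?_ ?_).symm
  · exact fun s _ _ => (hT.integrable_comp_of_integrable integrable_condExp).integrableOn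
  · rintro s ⟨t, ht, rfl⟩ _
    simp only [Function.comp_apply]
    rw [setIntegral_preimage_comp hT integrable_condExp.1 (hm t ht),
      setIntegral_preimage_comp hT hf.1 (hm t ht), setIntegral_condExp hm hf ht]
  · exact (stronglyMeasurable_condExp.comp_measurable
      (comap_measurable (m := m) T)).aestronglyMeasurable

variable {F₀ : MeasurableSpace Ω} [mΩ : MeasurableSpace Ω] {μ : Measure Ω}
  [IsProbabilityMeasure μ] {T : Ω → Ω}

lemma comap_iterate_succ (F₀ : MeasurableSpace Ω) (T : Ω → Ω) (n : ℕ) :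
    F₀.comap T^[n + 1] = (F₀.comap T).comap T^[n] := by
  rw [MeasurableSpace.comap_comp, ← Function.iterate_succ']

/-- The filtration `(T^n)⁻¹ F₀`. -/
def iterFiltration (hT : Measurable T) (hF : F₀ ≤ mΩ) (hFT : F₀ ≤ F₀.comap T) : Filtration ℕ mΩ where
  seq n := F₀.comap T^[n]
  mono' := monotone_nat_of_le_succ fun n => by
    rw [comap_iterate_succ]; exact MeasurableSpace.comap_mono hFT
  le' n := (MeasurableSpace.comap_mono hF).trans (hT.iterate n).comap_le

/-- By invariance of the measure, each condition at time `n` is the one at time `0` pulled back by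
`T^[n]`. -/
lemma isClocked_iterate (hT : MeasurePreserving T μ μ) (hF : F₀ ≤ mΩ) (hFT : F₀ ≤ F₀.comap T)
    {a : ℝ} {d : Ω → E} {h : Ω → ℝ} (hd : StronglyMeasurable[F₀.comap T] d) (hd2 : MemLp d 2 μ)
    (hd0 : μ[d | F₀] =ᵐ[μ] 0) (hh : Measurable[F₀] h) (h0 : ∀ ω, 0 ≤ h ω) (ha : ∀ ω, h ω ≤ a)
    (hsq : ∀ s, MeasurableSet[F₀] s → ∫ ω in s, ‖d ω‖ ^ 2 ∂μ ≤ ∫ ω in s, h ω ∂μ) :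
    IsClocked μ (iterFiltration hT.measurable hF hFT) a (fun n ω => d (T^[n] ω))
      (fun n ω => h (T^[n] ω)) where
  diff :=
    { integrable := fun n =>
        (hT.iterate n).integrable_comp_of_integrable (hd2.integrable (by norm_num))
      stronglyMeasurable := fun n => by
        change StronglyMeasurable[F₀.comap T^[n + 1]] _
        rw [comap_iterate_succ]
        exact hd.comp_measurable (comap_measurable (m := F₀.comap T) _)
      condExp_eq_zero := fun n => by
        refine (condExp_comp_comap (hT.iterate n) hF (hd2.integrable (by norm_num))).trans ?_
        filter_upwards [(hT.iterate n).quasiMeasurePreserving.ae hd0] with ω hω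
        exact hω }
  memLp n := hd2.comp_measurePreserving (hT.iterate n)
  measurable n := hh.comp (comap_measurable (m := F₀) _)
  nonneg n ω := h0 _
  le n ω := ha _
  sq_le := by
    rintro n s ⟨t, ht, rfl⟩
    have h1 := setIntegral_preimage_comp (hT.iterate n) (f := fun ω => ‖d ω‖ ^ 2)
      (hd2.1.norm.pow 2) (hF t ht)
    have h2 := setIntegral_preimage_comp (hT.iterate n) (f := h)
      (hh.mono hF le_rfl).aestronglyMeasurable (hF t ht)
    rw [h1, h2]
    exact hsq t ht

/-- Passing from a bound for the truncated sums to one for the Birkhoff sums. -/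
lemma norm_birkhoffSum_le_of_truncated {d : Ω → E} {h : Ω → ℝ} {a c : ℝ} {n : ℕ} {ω : Ω}
    (hc : ‖∑ l ∈ Finset.range n, {ω | h ω ≤ a}.indicator d (T^[l] ω)‖ ≤ c +
      ∑ l ∈ Finset.range n, {ω | Real.sqrt a < ‖{ω | h ω ≤ a}.indicator d (T^[l] ω)‖}.indicator
        (fun ω => ‖{ω | h ω ≤ a}.indicator d (T^[l] ω)‖) ω) :
    ‖birkhoffSum T d n ω‖ ≤ c + ∑ l ∈ Finset.range n,
      ({ω | Real.sqrt a < ‖d ω‖}.indicator (fun ω => ‖d ω‖) (T^[l] ω) +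
        {ω | a < h ω}.indicator (fun ω => ‖d ω‖) (T^[l] ω)) := by
  have h1 : birkhoffSum T d n ω = ∑ l ∈ Finset.range n, {ω | h ω ≤ a}.indicator d (T^[l] ω) +
      ∑ l ∈ Finset.range n, {ω | a < h ω}.indicator d (T^[l] ω) := by
    rw [birkhoffSum, ← Finset.sum_add_distrib]
    refine Finset.sum_congr rfl fun l _ => ?_
    by_cases hl : h (T^[l] ω) ≤ a
    · simp [Set.indicator, hl]
    · simp [Set.indicator, hl, lt_of_not_ge hl]
  have h2 : ‖∑ l ∈ Finset.range n, {ω | a < h ω}.indicator d (T^[l] ω)‖ ≤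
      ∑ l ∈ Finset.range n, {ω | a < h ω}.indicator (fun ω => ‖d ω‖) (T^[l] ω) := by
    refine (norm_sum_le _ _).trans (le_of_eq (Finset.sum_congr rfl fun l _ => ?_))
    by_cases hl : a < h (T^[l] ω) <;> simp [Set.indicator, hl]
  have h3 : ∑ l ∈ Finset.range n,
      {ω | Real.sqrt a < ‖{ω | h ω ≤ a}.indicator d (T^[l] ω)‖}.indicator
        (fun ω => ‖{ω | h ω ≤ a}.indicator d (T^[l] ω)‖) ω ≤
      ∑ l ∈ Finset.range n, {ω | Real.sqrt a < ‖d ω‖}.indicator (fun ω => ‖d ω‖) (T^[l] ω) := by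
    refine Finset.sum_le_sum fun l _ => ?_
    by_cases hl : h (T^[l] ω) ≤ a
    · simp [Set.indicator, hl]
    · simp only [Set.indicator, Set.mem_ofPred_eq, hl, if_false, norm_zero, ite_self]
      split_ifs <;> positivity
  rw [h1, Finset.sum_add_distrib]
  linarith [norm_add_le (∑ l ∈ Finset.range n, {ω | h ω ≤ a}.indicator d (T^[l] ω))
    (∑ l ∈ Finset.range n, {ω | a < h ω}.indicator d (T^[l] ω))]

end Stationary

end HannanLIL

end

noncomputable section

namespace HannanLIL

/-! ### Tail bound for stationary martingale differences -/

section Tail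

lemma profile_sq_mul_level (j : ℕ) : profile j ^ 2 * level j = 2 ^ j := by
  rw [profile, Real.sq_sqrt (div_nonneg (by positivity) (level_pos j).le),
    div_mul_cancel₀ _ (level_pos j).ne']

/-- Here `x` plays the norm of a difference and `z` its conditional second moment. The profiles
below a threshold sum to at most `8` times it, which gives `8/c · (x² + √z x)`, and the mixed term
is split by the arithmetic-geometric inequality. -/
lemma tsum_truncation_le {c x z : ℝ} (hc : 0 < c) (hx : 0 ≤ x) (hz : 0 ≤ z) :
    ∑' j, ENNReal.ofReal (profile j * ((if c * profile j < x then x else 0) +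
      (if (c * profile j) ^ 2 < z then x else 0)))
      ≤ ENNReal.ofReal (8 / c * (3 / 2 * x ^ 2 + 1 / 2 * z)) := by
  have h1 : ∀ j, ENNReal.ofReal (profile j * ((if c * profile j < x then x else 0) +
      (if (c * profile j) ^ 2 < z then x else 0))) =
      ENNReal.ofReal (if profile j < x / c then profile j else 0) * ENNReal.ofReal x +
      ENNReal.ofReal (if profile j < Real.sqrt z / c then profile j else 0) * ENNReal.ofReal x := by
    intro j
    have hp := (profile_pos j).le
    have e1 : c * profile j < x ↔ profile j < x / c := by rw [lt_div_iff₀ hc, mul_comm]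
    have e2 : (c * profile j) ^ 2 < z ↔ profile j < Real.sqrt z / c := by
      rw [lt_div_iff₀ hc, mul_comm, Real.lt_sqrt (by positivity)]
    simp only [e1, e2]
    rw [← ENNReal.ofReal_mul' hx, ← ENNReal.ofReal_mul' hx, ← ENNReal.ofReal_add]
    · congr 1
      split_ifs <;> ring
    · split_ifs <;> positivity
    · split_ifs <;> positivity
  simp only [h1]
  rw [ENNReal.tsum_add, ENNReal.tsum_mul_right, ENNReal.tsum_mul_right]
  have h2 := tsum_profile_lt_le (x := x / c) (by positivity)
  have h3 := tsum_profile_lt_le (x := Real.sqrt z / c) (by positivity)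
  refine (add_le_add (mul_le_mul_left h2 _) (mul_le_mul_left h3 _)).trans ?_
  rw [← ENNReal.ofReal_mul' hx, ← ENNReal.ofReal_mul' hx, ← ENNReal.ofReal_add (by positivity)
    (by positivity)]
  refine ENNReal.ofReal_le_ofReal ?_
  have h4 : Real.sqrt z * x ≤ 1 / 2 * x ^ 2 + 1 / 2 * z := by
    nlinarith [Real.sq_sqrt hz, sq_nonneg (x - Real.sqrt z)]
  calc 8 * (x / c) * x + 8 * (Real.sqrt z / c) * x = 8 / c * (x ^ 2 + Real.sqrt z * x) := by ring
    _ ≤ 8 / c * (3 / 2 * x ^ 2 + 1 / 2 * z) :=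
      mul_le_mul_of_nonneg_left (by linarith) (by positivity)

/-- Of the exponent, `κ` is kept and `2 * level j` is spent on summability: `2 ^ level j ≥ j + 2`
leaves a telescoping series. -/
lemma tsum_two_inv_pow_level_le (κ : ℕ) (hκ : 1 ≤ κ) :
    ∑' j, (2 : ℝ≥0∞) * 2⁻¹ ^ (3 * (κ * level j)) ≤ 2 * 2⁻¹ ^ κ := by
  rw [ENNReal.tsum_mul_left]
  have h1 : ∀ j, (2⁻¹ : ℝ≥0∞) ^ (3 * (κ * level j)) ≤
      2⁻¹ ^ κ * ENNReal.ofReal (1 / ((j : ℝ) + 1) - 1 / ((j : ℝ) + 2)) := by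
    intro j
    have h2 : κ + 2 * level j ≤ 3 * (κ * level j) := by
      have := two_le_level j
      nlinarith
    refine (pow_le_pow_of_le_one zero_le (by simp) h2).trans ?_
    rw [pow_add]
    gcongr
    rw [show (2⁻¹ : ℝ≥0∞) = ENNReal.ofReal 2⁻¹ by
      rw [ENNReal.ofReal_inv_of_pos (by norm_num)]; norm_num,
      ← ENNReal.ofReal_pow (by norm_num)]
    refine ENNReal.ofReal_le_ofReal ?_
    have h3 : ((j : ℝ) + 2) ≤ 2 ^ level j := by exact_mod_cast lt_two_pow_level j
    rw [mul_comm 2, pow_mul, inv_pow, inv_pow]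
    calc (((2 : ℝ) ^ level j) ^ 2)⁻¹ ≤ (((j : ℝ) + 2) ^ 2)⁻¹ := by gcongr
      _ ≤ 1 / ((j : ℝ) + 1) - 1 / ((j : ℝ) + 2) := by
        rw [div_sub_div _ _ (by positivity) (by positivity), inv_eq_one_div,
          div_le_div_iff₀ (by positivity) (by positivity)]
        nlinarith [(Nat.cast_nonneg j : (0 : ℝ) ≤ j)]
  have h4 : ∑' j : ℕ, ENNReal.ofReal (1 / ((j : ℝ) + 1) - 1 / ((j : ℝ) + 2)) ≤ 1 := by
    refine ENNReal.tsum_le_of_sum_range_le fun n => ?_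
    rw [← ENNReal.ofReal_sum_of_nonneg]
    · rw [← ENNReal.ofReal_one]
      refine ENNReal.ofReal_le_ofReal ?_
      have h5 := Finset.sum_range_sub' (fun j : ℕ => 1 / ((j : ℝ) + 1)) n
      have h6 : ∑ j ∈ Finset.range n, (1 / ((j : ℝ) + 1) - 1 / ((j : ℝ) + 2)) =
          ∑ j ∈ Finset.range n, (1 / ((j : ℝ) + 1) - 1 / (((j + 1 : ℕ) : ℝ) + 1)) := by
        refine Finset.sum_congr rfl fun j _ => ?_
        push_cast
        ring
      rw [h6, h5]
      have : (0 : ℝ) ≤ 1 / ((n : ℝ) + 1) := by positivity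
      norm_num
      simpa using this
    · intro j _
      rw [sub_nonneg]
      gcongr
      norm_num
  gcongr
  calc ∑' j, (2⁻¹ : ℝ≥0∞) ^ (3 * (κ * level j))
      ≤ ∑' j : ℕ, 2⁻¹ ^ κ * ENNReal.ofReal (1 / ((j : ℝ) + 1) - 1 / ((j : ℝ) + 2)) :=
        ENNReal.tsum_le_tsum h1
    _ ≤ 2⁻¹ ^ κ * 1 := by rw [ENNReal.tsum_mul_left]; gcongr
    _ = 2⁻¹ ^ κ := mul_one _

variable {Ω : Type u} {E : Type v} [NormedAddCommGroup E] [NormedSpace ℝ E] [CompleteSpace E]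
  {F₀ : MeasurableSpace Ω} [mΩ : MeasurableSpace Ω] {μ : Measure Ω}
  [IsProbabilityMeasure μ] {T : Ω → Ω}

/-- The part of `‖d‖` where `d` or its conditional second moment `h` is large. -/
def bigPart (d : Ω → E) (h : Ω → ℝ) (a : ℝ) (ω : Ω) : ℝ :=
  {ω | Real.sqrt a < ‖d ω‖}.indicator (fun ω => ‖d ω‖) ω + {ω | a < h ω}.indicator (fun ω => ‖d ω‖) ω

lemma bigPart_nonneg (d : Ω → E) (h : Ω → ℝ) (a : ℝ) (ω : Ω) : 0 ≤ bigPart d h a ω :=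
  add_nonneg (Set.indicator_nonneg (fun _ _ => norm_nonneg _) _)
    (Set.indicator_nonneg (fun _ _ => norm_nonneg _) _)

lemma measurable_bigPart {d : Ω → E} {h : Ω → ℝ} (hd : StronglyMeasurable d) (hh : Measurable h)
    (a : ℝ) : Measurable (bigPart d h a) :=
  (hd.norm.measurable.indicator (measurableSet_lt measurable_const hd.norm.measurable)).add
    (hd.norm.measurable.indicator (measurableSet_lt measurable_const hh))

/-- Markov's inequality and stationarity; the `2^j` equal expectations divided by `rate j` produce
the factor `profile j`. -/
lemma measure_sum_bigPart_le (hT : MeasurePreserving T μ μ) {d : Ω → E} {h : Ω → ℝ}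
    (hd : StronglyMeasurable d) (hh : Measurable h) (a : ℝ) (j : ℕ) {y : ℝ} (hy : 0 < y) :
    μ {ω | y * rate j < ∑ l ∈ Finset.range (2 ^ j), bigPart d h a (T^[l] ω)} ≤
      ENNReal.ofReal (1 / y) * ∫⁻ ω, ENNReal.ofReal (profile j * bigPart d h a ω) ∂μ := by
  have hG := measurable_bigPart hd hh a
  have hr := rate_pos j
  have hGl : ∀ l, Measurable fun ω => ENNReal.ofReal (bigPart d h a (T^[l] ω)) := fun l =>
    (hG.comp (hT.measurable.iterate l)).ennreal_ofReal
  have hsub : {ω | y * rate j < ∑ l ∈ Finset.range (2 ^ j), bigPart d h a (T^[l] ω)} ⊆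
      {ω | ENNReal.ofReal (y * rate j) ≤
        ∑ l ∈ Finset.range (2 ^ j), ENNReal.ofReal (bigPart d h a (T^[l] ω))} := by
    intro ω hω
    simp only [Set.mem_ofPred_eq] at hω ⊢
    rw [← ENNReal.ofReal_sum_of_nonneg fun l _ => bigPart_nonneg d h a _]
    exact ENNReal.ofReal_le_ofReal hω.le
  refine (measure_mono hsub).trans ?_
  refine (meas_ge_le_lintegral_div (Finset.measurable_fun_sum _ fun l _ => hGl l).aemeasurable
    (by simpa using mul_pos hy hr) ENNReal.ofReal_ne_top).trans ?_
  rw [lintegral_finsetSum _ fun l _ => hGl l]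
  have h1 : ∀ l ∈ Finset.range (2 ^ j), ∫⁻ ω, ENNReal.ofReal (bigPart d h a (T^[l] ω)) ∂μ =
      ∫⁻ ω, ENNReal.ofReal (bigPart d h a ω) ∂μ := fun l _ =>
    (hT.iterate l).lintegral_comp hG.ennreal_ofReal
  rw [Finset.sum_congr rfl h1, Finset.sum_const, Finset.card_range, nsmul_eq_mul]
  have h2 : ∫⁻ ω, ENNReal.ofReal (profile j * bigPart d h a ω) ∂μ =
      ENNReal.ofReal (profile j) * ∫⁻ ω, ENNReal.ofReal (bigPart d h a ω) ∂μ := by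
    rw [← lintegral_const_mul _ hG.ennreal_ofReal]
    simp only [ENNReal.ofReal_mul (profile_pos j).le]
  rw [h2, ← two_pow_div_rate, ← mul_assoc, ← ENNReal.ofReal_mul (by positivity), div_eq_mul_inv,
    mul_right_comm]
  gcongr
  rw [← ENNReal.ofReal_inv_of_pos (by positivity), show (((2 ^ j : ℕ) : ℝ≥0∞)) =
    ENNReal.ofReal (2 ^ j) by rw [← ENNReal.ofReal_natCast]; push_cast; rfl,
    ← ENNReal.ofReal_mul (by positivity)]
  refine ENNReal.ofReal_le_ofReal (le_of_eq ?_)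
  field_simp

/-- Summing over scales inside the expectation leaves `8/c · (3/2 ‖d‖² + 1/2 h)`. Both terms have
the same mean up to their coefficients, so `16 = 8 (3/2 + 1/2)`. -/
lemma tsum_measure_sum_bigPart_le (hT : MeasurePreserving T μ μ) {d : Ω → E} {h : Ω → ℝ}
    (hd : StronglyMeasurable d) (hd2 : MemLp d 2 μ) (hh : Measurable h) (h0 : ∀ ω, 0 ≤ h ω)
    (hint : Integrable h μ) (hI : ∫ ω, h ω ∂μ = ∫ ω, ‖d ω‖ ^ 2 ∂μ) {c y : ℝ} (hc : 0 < c)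
    (hy : 0 < y) :
    ∑' j, μ {ω | y * rate j <
      ∑ l ∈ Finset.range (2 ^ j), bigPart d h ((c * profile j) ^ 2) (T^[l] ω)} ≤
      ENNReal.ofReal (16 * (∫ ω, ‖d ω‖ ^ 2 ∂μ) / (c * y)) := by
  have hnd : Integrable (fun ω => ‖d ω‖ ^ 2) μ := hd2.integrable_norm_pow (by norm_num)
  refine (ENNReal.tsum_le_tsum fun j =>
    measure_sum_bigPart_le hT hd hh ((c * profile j) ^ 2) j hy).trans ?_
  rw [ENNReal.tsum_mul_left, ← lintegral_tsum fun j =>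
    ((measurable_bigPart hd hh _).const_mul _).ennreal_ofReal.aemeasurable]
  have h1 : ∀ ω, ∑' j, ENNReal.ofReal (profile j * bigPart d h ((c * profile j) ^ 2) ω) ≤
      ENNReal.ofReal (8 / c * (3 / 2 * ‖d ω‖ ^ 2 + 1 / 2 * h ω)) := by
    intro ω
    refine le_trans (le_of_eq ?_) (tsum_truncation_le hc (norm_nonneg (d ω)) (h0 ω))
    refine tsum_congr fun j => ?_
    have := profile_pos j
    simp only [bigPart, Set.indicator, Set.mem_ofPred_eq]
    rw [Real.sqrt_sq (by positivity)]
  have hint2 : Integrable (fun ω => 8 / c * (3 / 2 * ‖d ω‖ ^ 2 + 1 / 2 * h ω)) μ :=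
    ((hnd.const_mul _).add (hint.const_mul _)).const_mul _
  refine (mul_le_mul_right (lintegral_mono h1) _).trans ?_
  rw [← ofReal_integral_eq_lintegral_ofReal hint2
    (ae_of_all _ fun ω => by have := h0 ω; positivity), ← ENNReal.ofReal_mul (by positivity),
    integral_const_mul, integral_add (hnd.const_mul _) (hint.const_mul _), integral_const_mul,
    integral_const_mul, hI]
  refine ENNReal.ofReal_le_ofReal (le_of_eq ?_)
  field_simp
  ring

/-- Weak maximal inequality for stationary martingale differences, with a free parameter `κ`. -/
theorem measure_lt_norm_birkhoffSum_le {D : ℝ} (hE : IsTwoSmooth.{u, v} E D)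
    (hT : MeasurePreserving T μ μ) (hF : F₀ ≤ mΩ) (hFT : F₀ ≤ F₀.comap T) {d : Ω → E}
    (hd : StronglyMeasurable[F₀.comap T] d) (hd2 : MemLp d 2 μ) (hd0 : μ[d | F₀] =ᵐ[μ] 0)
    {c : ℝ} (hc : 0 < c) {κ : ℕ} (hκ : 1 ≤ κ) :
    μ {ω | ∃ n : ℕ, 1 ≤ n ∧ 84 * D * (c * κ) * lilRate n < ‖birkhoffSum T d n ω‖} ≤
      ENNReal.ofReal (17 * (∫ ω, ‖d ω‖ ^ 2 ∂μ) / (c ^ 2 * κ)) + 2 * 2⁻¹ ^ κ := by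
  have hD := hE.one_le
  have hκ0 : (0 : ℝ) < κ := by exact_mod_cast hκ
  have hFT' : F₀.comap T ≤ mΩ := (MeasurableSpace.comap_mono hF).trans hT.measurable.comap_le
  have hdm : StronglyMeasurable d := hd.mono hFT'
  have hnd : Integrable (fun ω => ‖d ω‖ ^ 2) μ := hd2.integrable_norm_pow (by norm_num)
  set g := μ[fun ω => ‖d ω‖ ^ 2 | F₀] with hg
  -- A version of the conditional second moment that is nonnegative everywhere.
  set h : Ω → ℝ := fun ω => max (g ω) 0 with hh
  have hhF : Measurable[F₀] h :=
    Measurable.max (stronglyMeasurable_condExp (m := F₀)).measurable measurable_const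
  have hhm : Measurable h := hhF.mono hF le_rfl
  have h0 : ∀ ω, 0 ≤ h ω := fun ω => le_max_right _ _
  have hgh : g =ᵐ[μ] h := by
    filter_upwards [condExp_nonneg (m := F₀) (μ := μ) (f := fun ω => ‖d ω‖ ^ 2)
      (ae_of_all _ fun ω => by positivity)] with ω hω
    exact (max_eq_left hω).symm
  have hint : Integrable h μ := integrable_condExp.congr hgh
  have hset : ∀ s, MeasurableSet[F₀] s → ∫ ω in s, h ω ∂μ = ∫ ω in s, ‖d ω‖ ^ 2 ∂μ := by
    intro s hs
    rw [← setIntegral_condExp hF hnd hs]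
    exact integral_congr_ae (ae_restrict_of_ae hgh.symm)
  have hI : ∫ ω, h ω ∂μ = ∫ ω, ‖d ω‖ ^ 2 ∂μ := by
    simpa using hset Set.univ (@MeasurableSet.univ _ F₀)
  -- With `K = κ * level j` this choice makes `K * a j = c² κ 2^j`, the clock budget of an ergodic
  -- average `c² κ`, and `√(a j) * K = c κ * rate j`.
  set a : ℕ → ℝ := fun j => (c * profile j) ^ 2 with ha
  have ha0 : ∀ j, 0 < a j := fun j => by have := profile_pos j; positivity
  have hsqa : ∀ j, Real.sqrt (a j) = c * profile j := fun j =>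
    Real.sqrt_sq (by have := profile_pos j; positivity)
  have hH : ∀ j, IsClocked μ (iterFiltration hT.measurable hF hFT) (a j)
      (fun n ω => {ω | h ω ≤ a j}.indicator d (T^[n] ω))
      (fun n ω => {ω | h ω ≤ a j}.indicator h (T^[n] ω)) := by
    intro j
    have hs : MeasurableSet[F₀] {ω | h ω ≤ a j} := measurableSet_le (mδ := F₀) hhF measurable_const
    refine isClocked_iterate hT hF hFT (hd.indicator (hFT _ hs)) (hd2.indicator (hF _ hs)) ?_
      (hhF.indicator hs) (fun ω => Set.indicator_nonneg (fun ω _ => h0 ω) _) ?_ ?_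
    · refine (condExp_indicator (hd2.integrable (by norm_num)) hs).trans ?_
      filter_upwards [hd0] with ω hω
      simp [Set.indicator, hω]
    · intro ω
      by_cases hω : h ω ≤ a j
      · rwa [Set.indicator_of_mem (by exact hω)]
      · rw [Set.indicator_of_notMem (by exact hω)]
        exact (ha0 j).le
    · intro s hms
      have e1 : (fun ω => ‖{ω | h ω ≤ a j}.indicator d ω‖ ^ 2) =
          {ω | h ω ≤ a j}.indicator (fun ω => ‖d ω‖ ^ 2) := by
        ext ω
        by_cases hω : h ω ≤ a j <;> simp [Set.indicator, hω]
      rw [e1, setIntegral_indicator (hF _ hs), setIntegral_indicator (hF _ hs),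
        hset _ (hms.inter hs)]
  set A : ℕ → Set Ω := fun j => {ω | ∑ l ∈ Finset.range (2 ^ j),
      {ω | h ω ≤ a j}.indicator h (T^[l] ω) ≤ (κ * level j : ℕ) * a j ∧ ∃ n ≤ 2 ^ j,
      20 * D * Real.sqrt (a j) * (κ * level j : ℕ) + ∑ l ∈ Finset.range n,
        {ω | Real.sqrt (a j) < ‖{ω | h ω ≤ a j}.indicator d (T^[l] ω)‖}.indicator
          (fun ω => ‖{ω | h ω ≤ a j}.indicator d (T^[l] ω)‖) ω
        < ‖∑ l ∈ Finset.range n, {ω | h ω ≤ a j}.indicator d (T^[l] ω)‖} with hA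
  set B : ℕ → Set Ω := fun j => {ω | (c * κ) * rate j <
      ∑ l ∈ Finset.range (2 ^ j), bigPart d h (a j) (T^[l] ω)} with hB
  -- Off this single event the clock budget holds at every scale, so no union over `j` is paid for
  -- the clock.
  set V : Set Ω := {ω | ∃ n : ℕ, n * (c ^ 2 * κ) < birkhoffSum T h n ω} with hV
  have hmA : ∑' j, μ (A j) ≤ 2 * 2⁻¹ ^ κ := by
    refine le_trans (ENNReal.tsum_le_tsum fun j => ?_) (tsum_two_inv_pow_level_le κ hκ)
    refine (hH j).measure_lt_norm_sum_le hE (ha0 j) (2 ^ j) (κ * level j) ?_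
    have := two_le_level j
    nlinarith
  have hmB : ∑' j, μ (B j) ≤ ENNReal.ofReal (16 * (∫ ω, ‖d ω‖ ^ 2 ∂μ) / (c * (c * κ))) :=
    tsum_measure_sum_bigPart_le hT hdm hd2 hhm h0 hint hI hc (by positivity)
  have hmV : μ V ≤ ENNReal.ofReal ((∫ ω, ‖d ω‖ ^ 2 ∂μ) / (c ^ 2 * κ)) := by
    rw [← hI]
    exact measure_lt_birkhoffSum_le hT hhm hint h0 (by positivity)
  have hsub : {ω | ∃ n : ℕ, 1 ≤ n ∧ 84 * D * (c * κ) * lilRate n < ‖birkhoffSum T d n ω‖} ⊆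
      (V ∪ ⋃ j, B j) ∪ ⋃ j, A j := by
    rintro ω ⟨n, hn, hlt⟩
    by_contra hcon
    simp only [Set.mem_union, Set.mem_iUnion, not_or, not_exists] at hcon
    obtain ⟨⟨hωV, hωB⟩, hωA⟩ := hcon
    set j := Nat.clog 2 n with hj
    have hnj : n ≤ 2 ^ j := Nat.le_pow_clog (by norm_num) n
    have hp := profile_pos j
    have hr := rate_pos j
    have hclock : ∑ l ∈ Finset.range (2 ^ j), {ω | h ω ≤ a j}.indicator h (T^[l] ω) ≤
        (κ * level j : ℕ) * a j := by
      have h1 : birkhoffSum T h (2 ^ j) ω ≤ (2 ^ j : ℕ) * (c ^ 2 * κ) := by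
        by_contra hcon
        exact hωV ⟨2 ^ j, not_le.1 hcon⟩
      have h2 : ∑ l ∈ Finset.range (2 ^ j), {ω | h ω ≤ a j}.indicator h (T^[l] ω) ≤
          birkhoffSum T h (2 ^ j) ω :=
        Finset.sum_le_sum fun l _ => Set.indicator_le_self' (fun ω _ => h0 ω) _
      refine (h2.trans h1).trans (le_of_eq ?_)
      have h3 := profile_sq_mul_level j
      push_cast
      rw [← h3, ha]
      ring
    have hmain := hωA j
    simp only [hA, Set.mem_ofPred_eq, not_and, not_exists, not_lt] at hmain
    have hle := norm_birkhoffSum_le_of_truncated (hmain hclock n hnj)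
    have hbig : ∑ l ∈ Finset.range n, bigPart d h (a j) (T^[l] ω) ≤ (c * κ) * rate j := by
      refine le_trans (Finset.sum_le_sum_of_subset_of_nonneg (Finset.range_mono hnj)
        fun l _ _ => bigPart_nonneg d h _ _) ?_
      exact not_lt.1 (hωB j)
    have h4 : 20 * D * Real.sqrt (a j) * (κ * level j : ℕ) = 20 * D * (c * κ) * rate j := by
      rw [hsqa, ← level_mul_profile]
      push_cast
      ring
    rw [h4] at hle
    have h5 : ‖birkhoffSum T d n ω‖ ≤ 20 * D * (c * κ) * rate j + (c * κ) * rate j :=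
      hle.trans (by gcongr; exact hbig)
    have h6 : (c * κ) * rate j ≤ D * ((c * κ) * rate j) :=
      le_mul_of_one_le_left (by positivity) hD
    -- The constant `84` is `(20 + 1) * 4`: martingale part, truncated part, and passage from `rate`
    -- to `lilRate`.
    have h7 : 21 * D * (c * κ) * rate j ≤ 21 * D * (c * κ) * (4 * lilRate n) := by
      gcongr
      exact rate_clog_le hn
    linarith
  calc μ {ω | ∃ n : ℕ, 1 ≤ n ∧ 84 * D * (c * κ) * lilRate n < ‖birkhoffSum T d n ω‖}
      ≤ μ ((V ∪ ⋃ j, B j) ∪ ⋃ j, A j) := measure_mono hsub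
    _ ≤ (μ V + ∑' j, μ (B j)) + ∑' j, μ (A j) :=
        (measure_union_le _ _).trans (add_le_add ((measure_union_le _ _).trans
          (add_le_add le_rfl (measure_iUnion_le _))) (measure_iUnion_le _))
    _ ≤ (ENNReal.ofReal ((∫ ω, ‖d ω‖ ^ 2 ∂μ) / (c ^ 2 * κ)) +
          ENNReal.ofReal (16 * (∫ ω, ‖d ω‖ ^ 2 ∂μ) / (c * (c * κ)))) + 2 * 2⁻¹ ^ κ := by gcongr
    _ = _ := by
        rw [← ENNReal.ofReal_add (by positivity) (by positivity)]
        congr 2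
        field_simp
        ring

end Tail

end HannanLIL

end

noncomputable section

namespace HannanLIL

/-! ### Strong `L^p` norms of extended nonnegative functions -/

section LpSize

variable {Ω : Type u} [mΩ : MeasurableSpace Ω] {μ : Measure Ω}

/-- The `L^p` norm of a nonnegative function. -/
def lpSize (f : Ω → ℝ≥0∞) (p : ℝ) (μ : Measure Ω) : ℝ≥0∞ := (∫⁻ ω, f ω ^ p ∂μ) ^ (1 / p)

lemma lpSize_mono_ae {f g : Ω → ℝ≥0∞} {p : ℝ} (hp : 1 ≤ p) (hfg : f ≤ᵐ[μ] g) :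
    lpSize f p μ ≤ lpSize g p μ := by
  unfold lpSize
  gcongr ?_ ^ (1 / p)
  refine lintegral_mono_ae ?_
  filter_upwards [hfg] with ω hω
  gcongr

lemma weakNorm_le_lpSize {f : Ω → ℝ≥0∞} (hf : AEMeasurable f μ) {p : ℝ} (hp : 1 ≤ p) :
    weakNorm f p μ ≤ lpSize f p μ := by
  have hp0 : 0 < p := by linarith
  refine iSup₂_le fun t ht => ?_
  have h1 : ENNReal.ofReal t ^ p * μ {ω | ENNReal.ofReal t < f ω} ≤ ∫⁻ ω, f ω ^ p ∂μ := by
    refine le_trans ?_ (mul_meas_ge_le_lintegral₀ (hf.pow_const p) (ENNReal.ofReal t ^ p))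
    gcongr with ω
    exact fun h => ENNReal.rpow_le_rpow h.le hp0.le
  calc ENNReal.ofReal t * μ {ω | ENNReal.ofReal t < f ω} ^ (1 / p)
      = (ENNReal.ofReal t ^ p * μ {ω | ENNReal.ofReal t < f ω}) ^ (1 / p) := by
        rw [ENNReal.mul_rpow_of_nonneg _ _ (by positivity), ← ENNReal.rpow_mul,
          mul_one_div_cancel hp0.ne', ENNReal.rpow_one]
    _ ≤ _ := by unfold lpSize; gcongr

lemma lpSize_finset_sum_le {ι : Type*} {f : ι → Ω → ℝ≥0∞} (hf : ∀ i, AEMeasurable (f i) μ) {p : ℝ}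
    (hp : 1 ≤ p) (s : Finset ι) :
    lpSize (fun ω => ∑ i ∈ s, f i ω) p μ ≤ ∑ i ∈ s, lpSize (f i) p μ := by
  classical
  have hp0 : 0 < p := by linarith
  induction s using Finset.induction_on with
  | empty => simp [lpSize, hp0, ENNReal.zero_rpow_of_pos]
  | insert i s hi ih =>
    simp only [Finset.sum_insert hi]
    refine (ENNReal.lintegral_Lp_add_le (hf i) (Finset.aemeasurable_fun_sum s fun i _ => hf i)
      hp).trans ?_
    gcongr
    exacts [le_rfl, ih]

lemma lpSize_tsum_le {ι : Type*} [Countable ι] {f : ι → Ω → ℝ≥0∞} (hf : ∀ i, AEMeasurable (f i) μ)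
    {p : ℝ} (hp : 1 ≤ p) :
    lpSize (fun ω => ∑' i, f i ω) p μ ≤ ∑' i, lpSize (f i) p μ := by
  have hp0 : 0 < p := by linarith
  have h1 : ∀ ω, (∑' i, f i ω) ^ p = ⨆ s : Finset ι, (∑ i ∈ s, f i ω) ^ p := by
    intro ω
    rw [ENNReal.tsum_eq_iSup_sum]
    exact (ENNReal.orderIsoRpow p hp0).map_iSup _
  have h2 : ∫⁻ ω, (∑' i, f i ω) ^ p ∂μ = ⨆ s : Finset ι, ∫⁻ ω, (∑ i ∈ s, f i ω) ^ p ∂μ := by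
    simp only [h1]
    refine lintegral_iSup_directed
      (fun s => (Finset.aemeasurable_fun_sum s fun i _ => hf i).pow_const p) ?_
    refine Monotone.directed_le fun s t hst ω => ?_
    dsimp only
    gcongr
  rw [lpSize, h2]
  rw [show (⨆ s : Finset ι, ∫⁻ ω, (∑ i ∈ s, f i ω) ^ p ∂μ) ^ (1 / p) =
    ⨆ s : Finset ι, (∫⁻ ω, (∑ i ∈ s, f i ω) ^ p ∂μ) ^ (1 / p) from
      (ENNReal.orderIsoRpow (1 / p) (by positivity)).map_iSup _]
  exact iSup_le fun s => (lpSize_finset_sum_le hf hp s).trans (ENNReal.sum_le_tsum s)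

/-- Dyadic layer cake bound. -/
lemma rpow_le_add_tsum {x b : ℝ≥0∞} (hb0 : b ≠ 0) (hb : b ≠ ∞) {p : ℝ} (hp : 0 < p) :
    x ^ p ≤ b ^ p + ∑' m : ℕ, if b * 2 ^ m < x then (b * 2 ^ (m + 1)) ^ p else 0 := by
  rcases le_or_gt x b with hx | hx
  · exact (ENNReal.rpow_le_rpow hx hp.le).trans le_self_add
  by_cases htop : x = ∞
  · have h1 : ∀ m : ℕ, b ^ p ≤ if b * 2 ^ m < x then (b * 2 ^ (m + 1)) ^ p else 0 := by
      intro m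
      rw [if_pos (by rw [htop]; exact ENNReal.mul_lt_top hb.lt_top (by finiteness))]
      gcongr
      exact le_mul_of_one_le_right zero_le (one_le_pow₀ (by norm_num))
    have h2 : ∑' _ : ℕ, b ^ p = ∞ :=
      ENNReal.tsum_const_eq_top_of_ne_zero (by
        simp [ENNReal.rpow_eq_zero_iff, hb0, hb])
    have h3 := ENNReal.tsum_le_tsum h1
    rw [h2, top_le_iff] at h3
    rw [h3]
    simp
  · have hex : ∃ m : ℕ, x ≤ b * 2 ^ m := by
      obtain ⟨m, hm⟩ := exists_nat_gt (x / b).toReal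
      refine ⟨m, ?_⟩
      have h1 : x / b ≠ ∞ := ENNReal.div_ne_top htop hb0
      have h2 : x / b ≤ m := by
        rw [← ENNReal.ofReal_toReal h1, ← ENNReal.ofReal_natCast]
        exact ENNReal.ofReal_le_ofReal hm.le
      rw [mul_comm]
      refine (ENNReal.div_le_iff hb0 hb).1 (h2.trans ?_)
      exact_mod_cast (Nat.lt_two_pow_self (n := m)).le
    classical
    obtain ⟨m, hm⟩ : ∃ m, Nat.find hex = m + 1 := by
      refine Nat.exists_eq_succ_of_ne_zero fun h0 => ?_
      have := Nat.find_spec hex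
      rw [h0, pow_zero, mul_one] at this
      exact absurd this (not_le.2 hx)
    have h1 := Nat.find_spec hex
    have h2 := Nat.find_min hex (m := m) (by omega)
    rw [hm] at h1
    rw [not_le] at h2
    refine le_trans ?_ le_add_self
    refine le_trans ?_ (ENNReal.le_tsum m)
    rw [if_pos h2]
    gcongr

end LpSize

/-! ### The maximal function and the constant `C_p` -/

section MaxFun

variable {Ω : Type u} {E : Type v} [NormedAddCommGroup E]
  [mΩ : MeasurableSpace Ω] {μ : Measure Ω} {θ : Equiv.Perm Ω}

lemma birkhoffSum_ae_eq (hθ : MeasurePreserving θ μ μ) {X Y : Ω → E} (h : X =ᵐ[μ] Y) :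
    ∀ᵐ ω ∂μ, ∀ n, birkhoffSum θ X n ω = birkhoffSum θ Y n ω :=
  ae_all_iff.2 fun n => hθ.quasiMeasurePreserving.birkhoffSum_ae_eq_of_ae_eq h n

lemma maxFun_ae_eq (hθ : MeasurePreserving θ μ μ) {X Y : Ω → E} (h : X =ᵐ[μ] Y) :
    maxFun θ X =ᵐ[μ] maxFun θ Y := by
  filter_upwards [birkhoffSum_ae_eq hθ h] with ω hω
  simp only [maxFun, hω]

lemma measurable_maxFun (hθ : Measurable θ) {X : Ω → E} (hX : StronglyMeasurable X) :
    Measurable (maxFun θ X) := by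
  refine .iSup fun n => .iSup fun _ => Measurable.div_const (StronglyMeasurable.enorm ?_) _
  exact Finset.stronglyMeasurable_fun_sum _ fun k _ => hX.comp_measurable (hθ.iterate k)

lemma aemeasurable_maxFun (hθ : MeasurePreserving θ μ μ) {X : Ω → E}
    (hX : AEStronglyMeasurable X μ) : AEMeasurable (maxFun θ X) μ :=
  ⟨maxFun θ (hX.mk X), measurable_maxFun hθ.measurable hX.stronglyMeasurable_mk,
    maxFun_ae_eq hθ hX.ae_eq_mk⟩

lemma hasSum_birkhoffSum (hθ : MeasurePreserving θ μ μ) {ι : Type*} {f : ι → Ω → E} {X : Ω → E}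
    (h : ∀ᵐ ω ∂μ, HasSum (fun i => f i ω) (X ω)) :
    ∀ᵐ ω ∂μ, ∀ n, HasSum (fun i => birkhoffSum θ (f i) n ω) (birkhoffSum θ X n ω) := by
  have h1 : ∀ᵐ ω ∂μ, ∀ k : ℕ, HasSum (fun i => f i (θ^[k] ω)) (X (θ^[k] ω)) :=
    ae_all_iff.2 fun k => (hθ.iterate k).quasiMeasurePreserving.ae h
  filter_upwards [h1] with ω hω n
  exact hasSum_sum fun k _ => hω k

lemma maxFun_le_tsum (hθ : MeasurePreserving θ μ μ) {ι : Type*} {f : ι → Ω → E} {X : Ω → E}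
    (h : ∀ᵐ ω ∂μ, HasSum (fun i => f i ω) (X ω)) :
    ∀ᵐ ω ∂μ, maxFun θ X ω ≤ ∑' i, maxFun θ (f i) ω := by
  filter_upwards [hasSum_birkhoffSum hθ h] with ω hω
  refine iSup₂_le fun n hn => ?_
  rw [← (hω n).tsum_eq, div_eq_mul_inv]
  refine (mul_le_mul_left enorm_tsum_le_tsum_enorm _).trans ?_
  rw [← ENNReal.tsum_mul_right]
  refine ENNReal.tsum_le_tsum fun i => ?_
  rw [← div_eq_mul_inv]
  exact le_iSup₂ (f := fun (n : ℕ) (_ : 1 ≤ n) =>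
    ‖birkhoffSum θ (f i) n ω‖ₑ / ENNReal.ofReal (lilRate n)) n hn

/-- The numerical series controlling the `p`-th moment of the maximal function. -/
def momentSum (p : ℝ) : ℝ≥0∞ :=
  1 + ∑' m : ℕ, ((2 : ℝ≥0∞) ^ (m + 1)) ^ p * ENNReal.ofReal ((34 * m + 18) / 4 ^ m)

/-- The terms are of order `m (2^p / 4)^m`, and `2^p < 4`. -/
lemma momentSum_ne_top {p : ℝ} (hp2 : p < 2) : momentSum p ≠ ∞ := by
  refine ENNReal.add_ne_top.2 ⟨by simp, ?_⟩
  set r : ℝ := 2 ^ p / 4 with hr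
  have h2p : (0 : ℝ) < 2 ^ p := by positivity
  have hr1 : r < 1 := by
    rw [hr, div_lt_one (by norm_num)]
    calc (2 : ℝ) ^ p < 2 ^ (2 : ℝ) := Real.rpow_lt_rpow_of_exponent_lt (by norm_num) hp2
      _ = 4 := by norm_num
  have h1 : ∀ m : ℕ, ((2 : ℝ≥0∞) ^ (m + 1)) ^ p * ENNReal.ofReal ((34 * m + 18) / 4 ^ m) =
      ENNReal.ofReal (2 ^ p * (34 * ((m : ℝ) ^ 1 * r ^ m) + 18 * r ^ m)) := by
    intro m
    rw [show (2 : ℝ≥0∞) ^ (m + 1) = ENNReal.ofReal (2 ^ (m + 1)) by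
      rw [ENNReal.ofReal_pow (by norm_num)]; norm_num,
      ENNReal.ofReal_rpow_of_pos (by positivity), ← ENNReal.ofReal_mul (by positivity)]
    congr 1
    rw [← Real.rpow_natCast_mul (by norm_num), mul_comm ((m + 1 : ℕ) : ℝ) p,
      Real.rpow_mul_natCast (by norm_num), hr, div_pow, pow_succ]
    ring
  simp only [h1]
  have hr0 : 0 ≤ r := by positivity
  have hs1 := summable_pow_mul_geometric_of_norm_lt_one (R := ℝ) 1 (r := r)
    (by rwa [Real.norm_of_nonneg hr0])
  have hs2 := summable_geometric_of_lt_one hr0 hr1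
  exact (((hs1.mul_left 34).add (hs2.mul_left 18)).mul_left (2 ^ p)).tsum_ofReal_ne_top

/-- The constant of the maximal inequality. -/
def maxConst (p : ℝ) : ℝ := 84 * (momentSum p ^ (1 / p)).toReal

lemma maxConst_pos {p : ℝ} (hp1 : 1 ≤ p) (hp2 : p < 2) : 0 < maxConst p := by
  have h1 : (1 : ℝ≥0∞) ≤ momentSum p ^ (1 / p) :=
    ENNReal.one_le_rpow le_self_add (by positivity)
  have h2 : momentSum p ^ (1 / p) ≠ ∞ :=
    ENNReal.rpow_ne_top_of_nonneg (by positivity) (momentSum_ne_top hp2)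
  have := ENNReal.toReal_pos (zero_lt_one.trans_le h1).ne' h2
  unfold maxConst
  positivity

end MaxFun

/-! ### Maximal inequality for stationary martingale differences -/

section MartingaleMax

variable {Ω : Type u} {E : Type v} [NormedAddCommGroup E] [NormedSpace ℝ E] [CompleteSpace E]
  {F₀ : MeasurableSpace Ω} [mΩ : MeasurableSpace Ω] {μ : Measure Ω} [IsProbabilityMeasure μ]
  {θ : Equiv.Perm Ω}

/-- The height `2^m` requires `c κ = σ 2^m`, so the variance term costs `17 κ / 4^m`. Taking `κ = 2
m + 1` makes the exponential term exactly `4^(-m)` at the price of a factor linear in `m`. -/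
lemma measure_lt_maxFun_le {D : ℝ} (hE : IsTwoSmooth.{u, v} E D)
    (hθ : MeasurePreserving θ μ μ) (hF : F₀ ≤ mΩ) (hFT : F₀ ≤ F₀.comap θ) {d : Ω → E}
    (hd : StronglyMeasurable[F₀.comap θ] d) (hd2 : MemLp d 2 μ) (hd0 : μ[d | F₀] =ᵐ[μ] 0)
    {σ : ℝ} (hσ : 0 < σ) (hI : ∫ ω, ‖d ω‖ ^ 2 ∂μ ≤ σ ^ 2) (m : ℕ) :
    μ {ω | ENNReal.ofReal (84 * D * σ) * 2 ^ m < maxFun θ d ω} ≤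
      ENNReal.ofReal ((34 * m + 18) / 4 ^ m) := by
  have hD := hE.one_le
  set κ : ℕ := 2 * m + 1 with hκ
  have hκ0 : (0 : ℝ) < κ := by positivity
  set c : ℝ := σ * 2 ^ m / κ with hc
  have hc0 : 0 < c := by positivity
  have hcκ : c * κ = σ * 2 ^ m := by rw [hc]; field_simp
  have hsub : {ω | ENNReal.ofReal (84 * D * σ) * 2 ^ m < maxFun θ d ω} ⊆
      {ω | ∃ n : ℕ, 1 ≤ n ∧ 84 * D * (c * κ) * lilRate n < ‖birkhoffSum θ d n ω‖} := by
    intro ω hω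
    simp only [Set.mem_ofPred_eq, maxFun, lt_iSup_iff] at hω ⊢
    obtain ⟨n, hn, hlt⟩ := hω
    refine ⟨n, hn, ?_⟩
    have hr := lilRate_pos hn
    rw [ENNReal.lt_div_iff_mul_lt (Or.inl (by simpa using hr)) (Or.inl ENNReal.ofReal_ne_top),
      show (2 : ℝ≥0∞) ^ m = ENNReal.ofReal (2 ^ m) by
        rw [ENNReal.ofReal_pow (by norm_num)]; norm_num,
      ← ENNReal.ofReal_mul (by positivity), ← ENNReal.ofReal_mul (by positivity),
      ← ofReal_norm, ENNReal.ofReal_lt_ofReal_iff_of_nonneg (by positivity)] at hlt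
    rw [hcκ]
    linarith
  refine (measure_mono hsub).trans ((measure_lt_norm_birkhoffSum_le hE hθ hF hFT hd hd2 hd0 hc0
    (κ := κ) (by omega)).trans ?_)
  have h1 : (2 : ℝ≥0∞) * 2⁻¹ ^ κ = ENNReal.ofReal (1 / 4 ^ m) := by
    rw [hκ, pow_succ', ← mul_assoc, ENNReal.mul_inv_cancel (by norm_num) (by norm_num), one_mul,
      pow_mul, show (2⁻¹ : ℝ≥0∞) = ENNReal.ofReal 2⁻¹ by
        rw [ENNReal.ofReal_inv_of_pos (by norm_num)]; norm_num,
      ← ENNReal.ofReal_pow (by norm_num), ← ENNReal.ofReal_pow (by norm_num)]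
    congr 1
    norm_num [div_pow]
  rw [h1, ← ENNReal.ofReal_add (by positivity) (by positivity)]
  refine ENNReal.ofReal_le_ofReal ?_
  have h2 : c ^ 2 * κ = σ ^ 2 * 4 ^ m / κ := by
    rw [hc, show (4 : ℝ) ^ m = (2 ^ m) ^ 2 by rw [← pow_mul, mul_comm m, pow_mul]; norm_num]
    field_simp
  have h3 : 17 * (∫ ω, ‖d ω‖ ^ 2 ∂μ) / (c ^ 2 * κ) ≤ 17 * κ / 4 ^ m := by
    rw [h2, div_le_div_iff₀ (by positivity) (by positivity)]
    calc 17 * (∫ ω, ‖d ω‖ ^ 2 ∂μ) * 4 ^ m ≤ 17 * σ ^ 2 * 4 ^ m := by gcongr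
      _ = 17 * κ * (σ ^ 2 * 4 ^ m / κ) := by field_simp
  calc 17 * (∫ ω, ‖d ω‖ ^ 2 ∂μ) / (c ^ 2 * κ) + 1 / 4 ^ m ≤ 17 * κ / 4 ^ m + 1 / 4 ^ m := by gcongr
    _ = (34 * m + 18) / 4 ^ m := by
      rw [hκ]; push_cast; ring

lemma lpSize_maxFun_le_of_integral_le {D : ℝ} (hE : IsTwoSmooth.{u, v} E D)
    (hθ : MeasurePreserving θ μ μ) (hF : F₀ ≤ mΩ) (hFT : F₀ ≤ F₀.comap θ) {d : Ω → E}
    (hd : StronglyMeasurable[F₀.comap θ] d) (hd2 : MemLp d 2 μ) (hd0 : μ[d | F₀] =ᵐ[μ] 0)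
    {σ : ℝ} (hσ : 0 < σ) (hI : ∫ ω, ‖d ω‖ ^ 2 ∂μ ≤ σ ^ 2) {p : ℝ} (hp1 : 1 ≤ p) (hp2 : p < 2) :
    lpSize (maxFun θ d) p μ ≤ ENNReal.ofReal (maxConst p * D * σ) := by
  have hD := hE.one_le
  have hp0 : 0 < p := by linarith
  have hFT' : F₀.comap θ ≤ mΩ := (MeasurableSpace.comap_mono hF).trans hθ.measurable.comap_le
  have hM : Measurable (maxFun θ d) := measurable_maxFun hθ.measurable (hd.mono hFT')
  set b : ℝ≥0∞ := ENNReal.ofReal (84 * D * σ) with hb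
  have hb0 : b ≠ 0 := by simpa [hb] using by positivity
  have hb1 : b ≠ ∞ := ENNReal.ofReal_ne_top
  have hset : ∀ m : ℕ, MeasurableSet {ω | b * 2 ^ m < maxFun θ d ω} := fun m =>
    measurableSet_lt measurable_const hM
  have h1 : ∫⁻ ω, maxFun θ d ω ^ p ∂μ ≤ b ^ p * momentSum p := by
    calc ∫⁻ ω, maxFun θ d ω ^ p ∂μ
        ≤ ∫⁻ ω, (b ^ p + ∑' m : ℕ, if b * 2 ^ m < maxFun θ d ω then (b * 2 ^ (m + 1)) ^ p else 0) ∂μ :=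
          lintegral_mono fun ω => rpow_le_add_tsum hb0 hb1 hp0
      _ = b ^ p + ∑' m : ℕ, (b * 2 ^ (m + 1)) ^ p * μ {ω | b * 2 ^ m < maxFun θ d ω} := by
          rw [lintegral_add_left measurable_const, lintegral_const, measure_univ, mul_one,
            lintegral_tsum fun m => (Measurable.ite (hset m) measurable_const
              measurable_const).aemeasurable]
          congr 2
          ext m
          rw [← lintegral_indicator_const (hset m)]
          simp only [Set.indicator, Set.mem_ofPred_eq]
      _ ≤ b ^ p + ∑' m : ℕ, b ^ p * (((2 : ℝ≥0∞) ^ (m + 1)) ^ p *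
            ENNReal.ofReal ((34 * m + 18) / 4 ^ m)) := by
          refine add_le_add le_rfl (ENNReal.tsum_le_tsum fun m => ?_)
          rw [ENNReal.mul_rpow_of_nonneg _ _ hp0.le, mul_assoc]
          gcongr
          exact measure_lt_maxFun_le hE hθ hF hFT hd hd2 hd0 hσ hI m
      _ = b ^ p * momentSum p := by rw [ENNReal.tsum_mul_left, momentSum, mul_add, mul_one]
  have h2 : momentSum p ^ (1 / p) ≠ ∞ :=
    ENNReal.rpow_ne_top_of_nonneg (by positivity) (momentSum_ne_top hp2)
  calc lpSize (maxFun θ d) p μ ≤ (b ^ p * momentSum p) ^ (1 / p) := by unfold lpSize; gcongr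
    _ = b * momentSum p ^ (1 / p) := by
        rw [ENNReal.mul_rpow_of_nonneg _ _ (by positivity), ← ENNReal.rpow_mul,
          mul_one_div_cancel hp0.ne', ENNReal.rpow_one]
    _ = ENNReal.ofReal (maxConst p * D * σ) := by
        rw [← ENNReal.ofReal_toReal h2, hb, ← ENNReal.ofReal_mul (by positivity), maxConst]
        congr 1
        ring

/-- The maximal inequality for stationary martingale differences. -/
theorem lpSize_maxFun_le {D : ℝ} (hE : IsTwoSmooth.{u, v} E D)
    (hθ : MeasurePreserving θ μ μ) (hF : F₀ ≤ mΩ) (hFT : F₀ ≤ F₀.comap θ) {d : Ω → E}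
    (hd : StronglyMeasurable[F₀.comap θ] d) (hd2 : MemLp d 2 μ) (hd0 : μ[d | F₀] =ᵐ[μ] 0)
    {p : ℝ} (hp1 : 1 ≤ p) (hp2 : p < 2) :
    lpSize (maxFun θ d) p μ ≤ ENNReal.ofReal (maxConst p * D) * eLpNorm d 2 μ := by
  have hD := hE.one_le
  have hC := maxConst_pos hp1 hp2
  set s : ℝ := (eLpNorm d 2 μ).toReal with hs
  have hs0 : 0 ≤ s := ENNReal.toReal_nonneg
  have hI : ∫ ω, ‖d ω‖ ^ 2 ∂μ = s ^ 2 := by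
    rw [hs, hd2.eLpNorm_eq_integral_rpow_norm (by norm_num) (by norm_num),
      ENNReal.toReal_ofReal (by positivity), ← Real.rpow_natCast, ← Real.rpow_mul (by positivity)]
    simp
  rw [← ENNReal.ofReal_toReal hd2.eLpNorm_ne_top, ← hs, ← ENNReal.ofReal_mul (by positivity)]
  -- The preceding bound needs `σ > 0` while the norm of `d` may vanish, hence the slack `ε`.
  refine ENNReal.le_of_forall_pos_le_add fun ε hε _ => ?_
  have hδ : 0 < (ε : ℝ) / (maxConst p * D) := by positivity
  refine (lpSize_maxFun_le_of_integral_le hE hθ hF hFT hd hd2 hd0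
    (σ := s + ε / (maxConst p * D)) (by positivity) ?_ hp1 hp2).trans ?_
  · rw [hI]; gcongr; linarith
  · rw [← ENNReal.ofReal_coe_nnreal, ← ENNReal.ofReal_add (by positivity) (by positivity)]
    refine ENNReal.ofReal_le_ofReal (le_of_eq ?_)
    field_simp

end MartingaleMax

end HannanLIL

end

noncomputable section

namespace HannanLIL

/-! ### The two-sided filtration -/

section Filt

variable {Ω : Type u} {F₀ : MeasurableSpace Ω} {θ : Equiv.Perm Ω}

lemma filt_comap_zpow (F₀ : MeasurableSpace Ω) (θ : Equiv.Perm Ω) (m n : ℤ) :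
    (filt F₀ θ m).comap (θ ^ n : Equiv.Perm Ω) = filt F₀ θ (m + n) := by
  rw [filt, MeasurableSpace.comap_comp, ← Equiv.Perm.coe_mul, ← zpow_add]

lemma filt_comap (F₀ : MeasurableSpace Ω) (θ : Equiv.Perm Ω) (n : ℤ) :
    (filt F₀ θ n).comap θ = filt F₀ θ (n + 1) := by
  rw [← filt_comap_zpow, zpow_one]

lemma filt_mono (hFT : F₀ ≤ F₀.comap θ) : Monotone (filt F₀ θ) := by
  refine monotone_int_of_le_succ fun n => ?_
  have h1 : filt F₀ θ (n + 1) = (F₀.comap θ).comap (θ ^ n : Equiv.Perm Ω) := by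
    rw [MeasurableSpace.comap_comp, ← Equiv.Perm.coe_mul, ← zpow_one_add, add_comm]
  rw [h1]
  exact MeasurableSpace.comap_mono hFT

lemma filt_le [mΩ : MeasurableSpace Ω] (hF : F₀ ≤ mΩ)
    (hθ : ∀ n : ℤ, Measurable (θ ^ n : Equiv.Perm Ω)) (n : ℤ) : filt F₀ θ n ≤ mΩ :=
  (MeasurableSpace.comap_mono hF).trans (hθ n).comap_le

lemma measurePreserving_zpow [MeasurableSpace Ω] {μ : Measure Ω} {θ : Ω ≃ᵐ Ω}
    (hθ : MeasurePreserving θ μ μ) (n : ℤ) :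
    MeasurePreserving (θ.toEquiv ^ n : Equiv.Perm Ω) μ μ := by
  have h1 : ∀ k : ℕ, MeasurePreserving (θ.toEquiv ^ k : Equiv.Perm Ω) μ μ := by
    intro k
    rw [Equiv.Perm.coe_pow]
    exact hθ.iterate k
  have h2 : ∀ k : ℕ, MeasurePreserving ((θ.toEquiv⁻¹) ^ k : Equiv.Perm Ω) μ μ := by
    intro k
    rw [Equiv.Perm.coe_pow]
    exact (hθ.symm θ).iterate k
  obtain ⟨k, rfl | rfl⟩ := n.eq_nat_or_neg
  · rw [zpow_natCast]; exact h1 k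
  · rw [zpow_neg, ← inv_zpow, zpow_natCast]; exact h2 k

end Filt

/-! ### Decomposition into martingale projections -/

section Decomposition

variable {Ω : Type u} {E : Type v} [NormedAddCommGroup E] [NormedSpace ℝ E] [CompleteSpace E]
  {m : ℤ → MeasurableSpace Ω} [mΩ : MeasurableSpace Ω] {μ : Measure Ω} [IsProbabilityMeasure μ]

/-- A function that is a.e. equal to an `m n`-measurable one for all `n` is a.e. equal to a
tail measurable one. -/
lemma exists_stronglyMeasurable_iInf [TopologicalSpace.SeparableSpace E] (hm : Monotone m)
    {V : ℤ → Ω → E} (hV : ∀ n, StronglyMeasurable[m n] (V n)) {W : Ω → E}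
    (hW : ∀ n, V n =ᵐ[μ] W) :
    ∃ W', StronglyMeasurable[⨅ n, m n] W' ∧ W' =ᵐ[μ] W := by
  -- Discarding the first `k` terms does not alter the limit, so it is measurable for every `m
  -- (-k)`.
  set W' : Ω → E := fun ω => limUnder atTop (fun k : ℕ => V (-k) ω) with hW'
  have hk : ∀ k : ℕ, StronglyMeasurable[m (-k)] W' := by
    intro k
    have h1 : W' = fun ω => limUnder atTop (fun l : ℕ => V (-(l + k : ℕ)) ω) := by
      ext ω
      simp only [hW', limUnder]
      congr 1
      conv_lhs => rw [← map_add_atTop_eq_nat k, Filter.map_map]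
      rfl
    rw [h1]
    refine @StronglyMeasurable.limUnder _ _ _ (m (-k)) _ _ _ _ _ _ _ fun l => ?_
    exact (hV _).mono (hm (by push_cast; omega))
  refine ⟨W', ?_, ?_⟩
  · borelize E
    have h2 : Measurable[⨅ n, m n] W' := by
      intro s hs
      rw [MeasurableSpace.measurableSet_iInf]
      intro n
      exact hm (show -(n.natAbs : ℤ) ≤ n by omega) _ ((hk n.natAbs).measurable hs)
    exact h2.stronglyMeasurable
  · filter_upwards [ae_all_iff.2 hW] with ω hω
    simp only [hW', hω]
    exact tendsto_const_nhds.limUnder_eq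

/-- An integrable function whose conditional expectations vanish along a filtration has
vanishing conditional expectation given the generated σ-algebra. -/
lemma condExp_iSup_eq_zero (hm : Monotone m) (hle : ∀ n, m n ≤ mΩ) {Z : Ω → E}
    (hZ : Integrable Z μ) (h : ∀ n, μ[Z | m n] =ᵐ[μ] 0) : μ[Z | ⨆ n, m n] =ᵐ[μ] 0 := by
  have hle' : ⨆ n, m n ≤ mΩ := iSup_le hle
  have h1 : ∀ n s, MeasurableSet[m n] s → ∫ ω in s, Z ω ∂μ = 0 := by
    intro n s hs
    rw [← setIntegral_condExp (hle n) hZ hs, integral_congr_ae (ae_restrict_of_ae (h n))]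
    simp
  have huniv : ∫ ω, Z ω ∂μ = 0 := by
    simpa using h1 0 Set.univ (@MeasurableSet.univ _ (m 0))
  have h2 : ∀ s, MeasurableSet[⨆ n, m n] s → ∫ ω in s, Z ω ∂μ = 0 := by
    intro s hs
    induction s, hs using MeasurableSpace.induction_on_inter
      (MeasurableSpace.generateFrom_iUnion_measurableSet m).symm
      (isPiSystem_iUnion_of_monotone _ (fun n => @MeasurableSpace.isPiSystem_measurableSet _ (m n))
        (fun i j hij s hs => hm hij s hs)) with
    | empty => simp
    | basic s hs =>
      obtain ⟨n, hn⟩ := Set.mem_iUnion.1 hs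
      exact h1 n s hn
    | compl s hs ih =>
      rw [setIntegral_compl (hle' _ hs) hZ, ih, huniv, sub_zero]
    | iUnion f hd hf ih =>
      rw [integral_iUnion (fun i => hle' _ (hf i)) hd hZ.integrableOn]
      simp [ih]
  refine (ae_eq_condExp_of_forall_setIntegral_eq hle' hZ (g := 0) ?_ ?_ ?_).symm
  · exact fun s _ _ => integrableOn_zero
  · intro s hs _
    rw [h2 s hs]
    simp
  · exact stronglyMeasurable_zero.aestronglyMeasurable

lemma lintegral_enorm_le_eLpNorm_two {f : Ω → E} (hf : AEStronglyMeasurable f μ) :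
    ∫⁻ ω, ‖f ω‖ₑ ∂μ ≤ eLpNorm f 2 μ := by
  rw [← eLpNorm_one_eq_lintegral_enorm]
  exact eLpNorm_le_eLpNorm_of_exponent_le (by norm_num) hf

lemma ae_summable_of_tsum_eLpNorm {ι : Type*} [Countable ι] {f : ι → Ω → E}
    (hf : ∀ i, AEStronglyMeasurable (f i) μ) (hsum : ∑' i, eLpNorm (f i) 2 μ ≠ ∞) :
    ∑' i, ∫⁻ ω, ‖f i ω‖ₑ ∂μ ≠ ∞ ∧ ∀ᵐ ω ∂μ, Summable fun i => f i ω := by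
  have h1 : ∑' i, ∫⁻ ω, ‖f i ω‖ₑ ∂μ ≠ ∞ :=
    ne_top_of_le_ne_top hsum (ENNReal.tsum_le_tsum fun i => lintegral_enorm_le_eLpNorm_two (hf i))
  refine ⟨h1, ?_⟩
  rw [← lintegral_tsum fun i => (hf i).enorm] at h1
  filter_upwards [ae_lt_top' (AEMeasurable.tsum fun i => (hf i).enorm) h1] with ω hω
  exact Summable.of_enorm hω.ne

lemma integrable_tsum_of_tsum_lintegral {ι : Type*} [Countable ι] {f : ι → Ω → E}
    (hf : ∀ i, AEStronglyMeasurable (f i) μ) (hsum : ∑' i, ∫⁻ ω, ‖f i ω‖ₑ ∂μ ≠ ∞)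
    (hS : ∀ᵐ ω ∂μ, Summable fun i => f i ω) : Integrable (fun ω => ∑' i, f i ω) μ := by
  refine ⟨aestronglyMeasurable_of_tendsto_ae (atTop : Filter (Finset ι))
    (f := fun s ω => ∑ i ∈ s, f i ω) (fun s => Finset.aestronglyMeasurable_fun_sum s
      fun i _ => hf i) ?_, ?_⟩
  · filter_upwards [hS] with ω hω
    exact hω.hasSum
  · refine lt_of_le_of_lt (lintegral_mono fun ω => enorm_tsum_le_tsum_enorm) ?_
    rw [lintegral_tsum fun i => (hf i).enorm]
    exact hsum.lt_top

/-- A regular variable is the sum of its martingale projections. -/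
lemma hasSum_proj [TopologicalSpace.SeparableSpace E] (hm : Monotone m) (hle : ∀ n, m n ≤ mΩ)
    {X : Ω → E} (hX : Integrable X μ) (hreg : μ[X | ⨅ n, m n] =ᵐ[μ] 0)
    (hreg' : X - μ[X | ⨆ n, m n] =ᵐ[μ] 0)
    (hsum : ∑' n, eLpNorm (μ[X | m n] - μ[X | m (n - 1)]) 2 μ ≠ ∞) :
    ∀ᵐ ω ∂μ, HasSum (fun n => (μ[X | m n] - μ[X | m (n - 1)]) ω) (X ω) := by
  set p : ℤ → Ω → E := fun n => μ[X | m n] - μ[X | m (n - 1)] with hp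
  have hpi : ∀ n, Integrable (p n) μ := fun n => integrable_condExp.sub integrable_condExp
  have hpm : ∀ n, StronglyMeasurable[m n] (p n) := fun n =>
    stronglyMeasurable_condExp.sub (stronglyMeasurable_condExp.mono (hm (by omega)))
  obtain ⟨hL1, hS⟩ := ae_summable_of_tsum_eLpNorm (fun n => (hpi n).1) hsum
  have hp0 : ∀ n l, l ≤ n - 1 → μ[p n | m l] =ᵐ[μ] 0 := by
    intro n l hl
    have h1 := condExp_condExp_of_le (f := X) (μ := μ) (hm (show l ≤ n by omega)) (hle n)
    have h2 := condExp_condExp_of_le (f := X) (μ := μ) (hm hl) (hle (n - 1))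
    filter_upwards [condExp_sub (m := m l) (integrable_condExp (m := m n) (f := X) (μ := μ))
      (integrable_condExp (m := m (n - 1)) (f := X) (μ := μ)), h1, h2] with ω e1 e2 e3
    rw [e1, Pi.sub_apply, e2, e3]
    simp
  have hp1 : ∀ n l, n ≤ l → μ[p n | m l] = p n := fun n l hl =>
    condExp_of_stronglyMeasurable (hle l) ((hpm n).mono (hm hl)) (hpi n)
  set Y : Ω → E := fun ω => ∑' n, p n ω with hY
  have hYi : Integrable Y μ := integrable_tsum_of_tsum_lintegral (fun n => (hpi n).1) hL1 hS
  have hYc : ∀ l : MeasurableSpace Ω, μ[Y | l] =ᵐ[μ] fun ω => ∑' n, μ[p n | l] ω := fun l =>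
    condExp_tsum (fun n => (hpi n).1) hL1
  -- `X` and `Y` have the same projection `p n`, so the conditional expectations of `X - Y` do not
  -- depend on `n`.
  have hstep : ∀ n, μ[X - Y | m n] =ᵐ[μ] μ[X - Y | m (n - 1)] := by
    intro n
    have hdiff : ∀ᵐ ω ∂μ, μ[Y | m n] ω - μ[Y | m (n - 1)] ω = p n ω := by
      filter_upwards [hYc (m n), hYc (m (n - 1)), hS,
        ae_all_iff.2 fun k : {k // n < k} => hp0 k n (by have := k.2; omega),
        ae_all_iff.2 fun k : {k // n - 1 < k} => hp0 k (n - 1) (by have := k.2; omega)]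
        with ω e1 e2 e3 e4 e5
      have f1 : ∀ k, μ[p k | m n] ω = if k ≤ n then p k ω else 0 := by
        intro k
        split_ifs with hk
        · rw [hp1 k n hk]
        · exact e4 ⟨k, by omega⟩
      have f2 : ∀ k, μ[p k | m (n - 1)] ω = if k ≤ n - 1 then p k ω else 0 := by
        intro k
        split_ifs with hk
        · rw [hp1 k (n - 1) hk]
        · exact e5 ⟨k, by omega⟩
      have g1 : ∀ l : ℤ, Summable fun k => if k ≤ l then p k ω else 0 := fun l =>
        (e3.indicator {k | k ≤ l}).congr fun k => by
          by_cases hk : k ≤ l <;> simp [Set.indicator, hk]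
      rw [e1, e2]
      simp only [f1, f2]
      rw [← (g1 n).tsum_sub (g1 (n - 1)), tsum_eq_single n]
      · simp
      · intro k hk
        by_cases h1 : k ≤ n - 1
        · simp [h1, show k ≤ n by omega]
        · simp [h1, show ¬ k ≤ n by omega]
    filter_upwards [hdiff, condExp_sub (m := m n) hX hYi, condExp_sub (m := m (n - 1)) hX hYi]
      with ω e1 e2 e3
    rw [e2, e3, Pi.sub_apply, Pi.sub_apply, sub_eq_sub_iff_sub_eq_sub, e1]
    rfl
  have hall : ∀ n, μ[X - Y | m n] =ᵐ[μ] μ[X - Y | m 0] := by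
    intro n
    induction n using Int.induction_on with
    | zero => rfl
    | succ k ih =>
      have := hstep (k + 1)
      rw [add_sub_cancel_right] at this
      exact this.trans ih
    | pred k ih => exact (hstep _).symm.trans ih
  -- The common value is tail measurable. Since `X` and `Y` both have zero expectation given the
  -- tail, it vanishes.
  obtain ⟨W, hWm, hW⟩ := exists_stronglyMeasurable_iInf hm
    (fun n => stronglyMeasurable_condExp (m := m n) (f := X - Y) (μ := μ)) hall
  have hinf : ⨅ n, m n ≤ mΩ := (iInf_le m 0).trans (hle 0)
  have hYinf : μ[Y | ⨅ n, m n] =ᵐ[μ] 0 := by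
    have h1 : ∀ n, μ[p n | ⨅ n, m n] =ᵐ[μ] 0 := by
      intro n
      refine (condExp_condExp_of_le (iInf_le m (n - 1)) (hle (n - 1))).symm.trans ?_
      refine (condExp_congr_ae (hp0 n (n - 1) le_rfl)).trans ?_
      rw [condExp_zero]
    filter_upwards [hYc (⨅ n, m n), ae_all_iff.2 h1] with ω e1 e2
    rw [e1]
    simp [e2]
  have hZ0 : μ[X - Y | m 0] =ᵐ[μ] 0 := by
    have h1 : μ[μ[X - Y | m 0] | ⨅ n, m n] =ᵐ[μ] μ[X - Y | m 0] := by
      refine (condExp_congr_ae hW.symm).trans ?_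
      rw [condExp_of_stronglyMeasurable hinf hWm (integrable_condExp.congr hW.symm)]
      exact hW
    refine h1.symm.trans ((condExp_condExp_of_le (iInf_le m 0) (hle 0)).trans ?_)
    filter_upwards [condExp_sub (m := ⨅ n, m n) hX hYi, hreg, hYinf] with ω e1 e2 e3
    rw [e1, Pi.sub_apply, e2, e3]
    simp
  have hZsup := condExp_iSup_eq_zero hm hle (hX.sub hYi) fun n => (hall n).trans hZ0
  have hYsup : μ[Y | ⨆ n, m n] =ᵐ[μ] Y := by
    filter_upwards [hYc (⨆ n, m n)] with ω e1
    rw [e1]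
    refine tsum_congr fun n => ?_
    rw [condExp_of_stronglyMeasurable (iSup_le hle) ((hpm n).mono (le_iSup m n)) (hpi n)]
  filter_upwards [hS, hZsup, condExp_sub (m := ⨆ n, m n) hX hYi, hYsup, hreg']
    with ω e1 e2 e3 e4 e5
  have : X ω = Y ω := by
    have h1 : X ω = μ[X | ⨆ n, m n] ω := sub_eq_zero.1 e5
    rw [e3, Pi.sub_apply, ← h1, e4] at e2
    exact sub_eq_zero.1 e2
  rw [this]
  exact e1.hasSum

end Decomposition

end HannanLIL

end

noncomputable section

namespace HannanLIL

/-! ### Coboundaries are negligible -/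

section Coboundary

variable {Ω : Type u} {E : Type v} [NormedAddCommGroup E]
  [mΩ : MeasurableSpace Ω] {μ : Measure Ω} [IsProbabilityMeasure μ]

lemma lilRate_nonneg (n : ℕ) : 0 ≤ lilRate n := Real.sqrt_nonneg _

lemma sqrt_le_lilRate (n : ℕ) : Real.sqrt n ≤ lilRate n :=
  Real.sqrt_le_sqrt (le_mul_of_one_le_right (Nat.cast_nonneg n) (one_le_L _))

/-- Along the orbits, a square-integrable function is `o(√n)`. -/
lemma tendsto_norm_iterate_div_lilRate {T : Ω → Ω} (hT : MeasurePreserving T μ μ) {W : Ω → E}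
    (hW : MemLp W 2 μ) :
    ∀ᵐ ω ∂μ, Tendsto (fun n : ℕ => ‖W (T^[n] ω)‖ / lilRate n) atTop (𝓝 0) := by
  have hint : Integrable (fun ω => ‖W ω‖ ^ 2) μ := hW.integrable_norm_pow (by norm_num)
  -- Borel–Cantelli: by invariance the probabilities are those of `k ‖W‖² > n`, summable since
  -- `‖W‖²` is integrable. Letting `k` vary turns `O(√n)` into `o(√n)`.
  have h1 : ∀ k : ℕ, ∀ᵐ ω ∂μ, ∀ᶠ n : ℕ in atTop, (k : ℝ) * ‖W (T^[n] ω)‖ ^ 2 ≤ n := by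
    intro k
    have hi : Integrable (fun ω => (k : ℝ) * ‖W ω‖ ^ 2) μ := hint.const_mul _
    have h2 : (∑' n : ℕ, μ {ω | (k : ℝ) * ‖W (T^[n] ω)‖ ^ 2 ∈ Set.Ioi (n : ℝ)}) < ∞ := by
      let _ : MeasureSpace Ω := ⟨μ⟩
      have : IsProbabilityMeasure (ℙ : Measure Ω) := ‹IsProbabilityMeasure μ›
      refine lt_of_eq_of_lt (tsum_congr fun n => ?_)
        (tsum_prob_mem_Ioi_lt_top (X := fun ω => (k : ℝ) * ‖W ω‖ ^ 2) hi fun ω => by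
          simp only [Pi.zero_apply]; positivity)
      refine (hT.iterate n).measure_preimage (s := {ω | (k : ℝ) * ‖W ω‖ ^ 2 ∈ Set.Ioi (n : ℝ)}) ?_
      exact hi.1.aemeasurable.nullMeasurable measurableSet_Ioi
    filter_upwards [ae_eventually_notMem h2.ne] with ω hω
    filter_upwards [hω] with n hn
    simpa using hn
  filter_upwards [ae_all_iff.2 h1] with ω hω
  rw [Metric.tendsto_atTop]
  intro ε hε
  obtain ⟨k, hk⟩ := exists_nat_gt (1 / ε ^ 2)
  obtain ⟨N, hN⟩ := eventually_atTop.1 (hω k)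
  refine ⟨max N 1, fun n hn => ?_⟩
  have hn1 : 1 ≤ n := le_of_max_le_right hn
  have hn0 : (0 : ℝ) < n := by exact_mod_cast hn1
  have hr := lilRate_pos hn1
  have h3 := hN n (le_of_max_le_left hn)
  have hk0 : (0 : ℝ) < k := lt_trans (by positivity) hk
  rw [Real.dist_eq, sub_zero, abs_of_nonneg (by positivity), div_lt_iff₀ hr]
  refine lt_of_lt_of_le ?_ (mul_le_mul_of_nonneg_left (sqrt_le_lilRate n) hε.le)
  refine lt_of_pow_lt_pow_left₀ 2 (by positivity) ?_
  rw [mul_pow, Real.sq_sqrt hn0.le]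
  have h4 : 1 < ε ^ 2 * k := by rwa [div_lt_iff₀' (by positivity)] at hk
  have h5 : (k : ℝ) * ‖W (T^[n] ω)‖ ^ 2 < k * (ε ^ 2 * n) := by nlinarith
  exact lt_of_mul_lt_mul_left h5 hk0.le

variable {θ : Equiv.Perm Ω}

/-- The sum of length `n + k` is split in two ways, after `n` and after `k` terms. What remains has
fixed length `k`. -/
lemma birkhoffSum_sub_comp_pow (p : Ω → E) (k n : ℕ) (ω : Ω) :
    birkhoffSum θ (p - p ∘ (θ ^ k : Equiv.Perm Ω)) n ω =
      birkhoffSum θ p k ω - birkhoffSum θ p k (θ^[n] ω) := by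
  have h1 : birkhoffSum θ (p - p ∘ (θ ^ k : Equiv.Perm Ω)) n ω =
      birkhoffSum θ p n ω - birkhoffSum θ p n (θ^[k] ω) := by
    simp only [birkhoffSum, Pi.sub_apply, Finset.sum_sub_distrib, Function.comp_apply,
      Equiv.Perm.coe_pow, ← Function.iterate_add_apply]
    simp only [add_comm]
  have h2 := birkhoffSum_add θ p n k ω
  have h3 := birkhoffSum_add θ p k n ω
  rw [add_comm k n, h2] at h3
  rw [h1, sub_eq_sub_iff_add_eq_add, h3, add_comm]

lemma memLp_birkhoffSum (hθ : MeasurePreserving θ μ μ) {p : Ω → E} (hp : MemLp p 2 μ) (n : ℕ) :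
    MemLp (birkhoffSum θ p n) 2 μ :=
  memLp_finsetSum _ fun k _ => hp.comp_measurePreserving (hθ.iterate k)

/-- The Birkhoff sums of a coboundary are negligible. -/
lemma tendsto_birkhoffSum_coboundary (hθ : ∀ k : ℤ, MeasurePreserving (θ ^ k : Equiv.Perm Ω) μ μ)
    {p : Ω → E} (hp : MemLp p 2 μ) (k : ℤ) :
    ∀ᵐ ω ∂μ, Tendsto (fun n : ℕ =>
      ‖birkhoffSum θ (p - p ∘ (θ ^ k : Equiv.Perm Ω)) n ω‖ / lilRate n) atTop (𝓝 0) := by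
  have hθ1 : MeasurePreserving θ μ μ := by simpa using hθ 1
  have hnat : ∀ (q : Ω → E), MemLp q 2 μ → ∀ l : ℕ, ∀ᵐ ω ∂μ, Tendsto (fun n : ℕ =>
      ‖birkhoffSum θ (q - q ∘ (θ ^ l : Equiv.Perm Ω)) n ω‖ / lilRate n) atTop (𝓝 0) := by
    intro q hq l
    filter_upwards [tendsto_norm_iterate_div_lilRate hθ1 (memLp_birkhoffSum hθ1 hq l)] with ω hω
    have hrate : Tendsto lilRate atTop atTop :=
      tendsto_atTop_mono sqrt_le_lilRate
        (Real.tendsto_sqrt_atTop.comp tendsto_natCast_atTop_atTop)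
    have h1 : Tendsto (fun n : ℕ => ‖birkhoffSum θ q l ω‖ / lilRate n +
        ‖birkhoffSum θ q l (θ^[n] ω)‖ / lilRate n) atTop (𝓝 0) := by
      simpa using (hrate.const_div_atTop ‖birkhoffSum θ q l ω‖).add hω
    refine squeeze_zero (fun n => div_nonneg (norm_nonneg _) (lilRate_nonneg _)) (fun n => ?_) h1
    rw [birkhoffSum_sub_comp_pow, ← add_div]
    exact div_le_div_of_nonneg_right (norm_sub_le _ _) (lilRate_nonneg _)
  obtain ⟨l, rfl | rfl⟩ := k.eq_nat_or_neg
  · simpa using hnat p hp l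
  -- A negative shift is reduced to a positive one through `q = p ∘ θ^(-l)`, for which `q - q ∘ θ^l
  -- = -(p - p ∘ θ^(-l))`.
  · filter_upwards [hnat _ (hp.comp_measurePreserving (hθ (-l))) l] with ω hω
    have h1 : (p ∘ (θ ^ (-l : ℤ) : Equiv.Perm Ω)) - (p ∘ (θ ^ (-l : ℤ) : Equiv.Perm Ω)) ∘
        (θ ^ l : Equiv.Perm Ω) = -(p - p ∘ (θ ^ (-l : ℤ) : Equiv.Perm Ω)) := by
      ext ω
      simp
    rw [h1] at hω
    refine hω.congr fun n => ?_
    rw [show birkhoffSum θ (-(p - p ∘ (θ ^ (-l : ℤ) : Equiv.Perm Ω))) n ω =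
      -birkhoffSum θ (p - p ∘ (θ ^ (-l : ℤ) : Equiv.Perm Ω)) n ω from Finset.sum_neg_distrib _,
      norm_neg]

end Coboundary

/-! ### Summation of series under Birkhoff sums -/

section Approximation

variable {Ω : Type u} {E : Type v} [NormedAddCommGroup E] [NormedSpace ℝ E] [CompleteSpace E]
  [mΩ : MeasurableSpace Ω] {μ : Measure Ω} [IsProbabilityMeasure μ] {θ : Equiv.Perm Ω}

lemma eLpNorm_two_eq_lpSize (f : Ω → E) : eLpNorm f 2 μ = lpSize (fun ω => ‖f ω‖ₑ) 2 μ := by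
  rw [eLpNorm_eq_lintegral_rpow_enorm_toReal (by norm_num) (by norm_num), lpSize]
  norm_num

/-- A series of functions with summable `L²` norms converges in `L²`. -/
lemma eLpNorm_sum_sub_le {ι : Type*} [Countable ι] {f : ι → Ω → E} {g : Ω → E}
    (hf : ∀ i, AEStronglyMeasurable (f i) μ) (hg : ∀ᵐ ω ∂μ, HasSum (fun i => f i ω) (g ω))
    (s : Finset ι) :
    eLpNorm (∑ i ∈ s, f i - g) 2 μ ≤ ∑' i : {i // i ∉ s}, eLpNorm (f i) 2 μ := by
  have h1 : ∑' i : {i // i ∉ s}, eLpNorm (f i) 2 μ =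
      ∑' i : {i // i ∉ s}, lpSize (fun ω => ‖f i ω‖ₑ) 2 μ :=
    tsum_congr fun i => eLpNorm_two_eq_lpSize _
  rw [h1, eLpNorm_two_eq_lpSize]
  refine le_trans (lpSize_mono_ae (by norm_num) ?_)
    (lpSize_tsum_le (f := fun (i : {i // i ∉ s}) ω => ‖f i ω‖ₑ) (fun i => (hf i).enorm) (by norm_num))
  filter_upwards [hg] with ω hω
  have h2 : HasSum (fun i : {i // i ∉ s} => f i ω) (g ω - ∑ i ∈ s, f i ω) := by
    have := (s.hasSum_compl_iff (f := fun i => f i ω) (a := g ω - ∑ i ∈ s, f i ω)).2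
      (by simpa using hω)
    exact this
  rw [Pi.sub_apply, Finset.sum_apply, ← enorm_neg, neg_sub, ← h2.tsum_eq]
  exact enorm_tsum_le_tsum_enorm

lemma tendsto_eLpNorm_sum_sub {ι : Type*} [Countable ι] {f : ι → Ω → E} {g : Ω → E}
    (hf : ∀ i, AEStronglyMeasurable (f i) μ) (hg : ∀ᵐ ω ∂μ, HasSum (fun i => f i ω) (g ω))
    (hsum : ∑' i, eLpNorm (f i) 2 μ ≠ ∞) :
    Tendsto (fun s : Finset ι => eLpNorm (∑ i ∈ s, f i - g) 2 μ) atTop (𝓝 0) :=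
  tendsto_of_tendsto_of_tendsto_of_le_of_le tendsto_const_nhds
    (ENNReal.tendsto_tsum_compl_atTop_zero hsum) (fun _ => zero_le)
    (fun s => eLpNorm_sum_sub_le hf hg s)

/-- If `g = ∑ f i`, the maximal functions of the `f i` are summable in `L¹` and the Birkhoff sums of
each `f i` are negligible, then so are those of `g`. -/
lemma isLittleO_birkhoffSum_of_hasSum (hθ : MeasurePreserving θ μ μ) {ι : Type*} [Countable ι]
    {f : ι → Ω → E} {g : Ω → E} (hf : ∀ i, AEStronglyMeasurable (f i) μ)
    (hg : ∀ᵐ ω ∂μ, HasSum (fun i => f i ω) (g ω))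
    (hM : ∑' i, lpSize (maxFun θ (f i)) 1 μ ≠ ∞)
    (h0 : ∀ i, ∀ᵐ ω ∂μ, Tendsto (fun n : ℕ => ‖birkhoffSum θ (f i) n ω‖ / lilRate n) atTop (𝓝 0)) :
    ∀ᵐ ω ∂μ, (fun n : ℕ => birkhoffSum θ g n ω) =o[atTop] lilRate := by
  have h1 : ∫⁻ ω, ∑' i, maxFun θ (f i) ω ∂μ ≠ ∞ := by
    rw [lintegral_tsum fun i => aemeasurable_maxFun hθ (hf i)]
    simpa [lpSize] using hM
  filter_upwards [hasSum_birkhoffSum hθ hg, ae_all_iff.2 h0,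
    ae_lt_top' (AEMeasurable.tsum fun i => aemeasurable_maxFun hθ (hf i)) h1] with ω e1 e2 e3
  have hfin : ∀ i, maxFun θ (f i) ω ≠ ∞ := ENNReal.ne_top_of_tsum_ne_top e3.ne
  have hle : ∀ n : ℕ, 1 ≤ n → ∀ i,
      ‖birkhoffSum θ (f i) n ω‖ / lilRate n ≤ (maxFun θ (f i) ω).toReal := by
    intro n hn i
    have hr := lilRate_pos hn
    rw [← ENNReal.ofReal_le_iff_le_toReal (hfin i), ENNReal.ofReal_div_of_pos hr, ofReal_norm]
    exact le_iSup₂ (f := fun (n : ℕ) (_ : 1 ≤ n) =>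
      ‖birkhoffSum θ (f i) n ω‖ₑ / ENNReal.ofReal (lilRate n)) n hn
  -- The maximal functions dominate the normalised sums uniformly in `n`, and their sum over `i` is
  -- almost surely finite because its mean is.
  have key := tendsto_tsum_of_dominated_convergence (𝓕 := atTop)
    (f := fun (n : ℕ) i => (lilRate n)⁻¹ • birkhoffSum θ (f i) n ω) (g := fun _ => (0 : E))
    (bound := fun i => (maxFun θ (f i) ω).toReal) (ENNReal.summable_toReal e3.ne) ?_ ?_
  · rw [tsum_zero] at key
    rw [← isLittleO_norm_left, isLittleO_iff_tendsto']
    · have h2 := key.norm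
      rw [norm_zero] at h2
      refine h2.congr fun n => ?_
      rw [((e1 n).const_smul ((lilRate n)⁻¹)).tsum_eq, norm_smul, norm_inv,
        Real.norm_of_nonneg (lilRate_nonneg _), div_eq_inv_mul]
    · filter_upwards [eventually_ge_atTop 1] with n hn h
      exact absurd h (lilRate_pos hn).ne'
  · intro i
    rw [tendsto_zero_iff_norm_tendsto_zero]
    refine (e2 i).congr fun n => ?_
    rw [norm_smul, norm_inv, Real.norm_of_nonneg (lilRate_nonneg _), div_eq_inv_mul]
  · filter_upwards [eventually_ge_atTop 1] with n hn i
    refine le_trans (le_of_eq ?_) (hle n hn i)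
    rw [norm_smul, norm_inv, Real.norm_of_nonneg (lilRate_nonneg _), div_eq_inv_mul]

lemma maxFun_sub_le (f g : Ω → E) (ω : Ω) :
    maxFun θ (f - g) ω ≤ maxFun θ f ω + maxFun θ g ω := by
  refine iSup₂_le fun n hn => ?_
  have h1 : birkhoffSum θ (f - g) n ω = birkhoffSum θ f n ω - birkhoffSum θ g n ω := by
    simp [birkhoffSum, Finset.sum_sub_distrib]
  rw [h1]
  refine (ENNReal.div_le_div_right (enorm_sub_le) _).trans ?_
  rw [ENNReal.add_div]
  gcongr
  · exact le_iSup₂ (f := fun (n : ℕ) (_ : 1 ≤ n) =>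
      ‖birkhoffSum θ f n ω‖ₑ / ENNReal.ofReal (lilRate n)) n hn
  · exact le_iSup₂ (f := fun (n : ℕ) (_ : 1 ≤ n) =>
      ‖birkhoffSum θ g n ω‖ₑ / ENNReal.ofReal (lilRate n)) n hn

end Approximation

/-! ### Properties of the projections `P_n` -/

section Projection

variable {Ω : Type u} {E : Type v} [NormedAddCommGroup E] [NormedSpace ℝ E] [CompleteSpace E]
  {F₀ : MeasurableSpace Ω} [mΩ : MeasurableSpace Ω] {μ : Measure Ω} [IsProbabilityMeasure μ]
  {θ : Equiv.Perm Ω}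

lemma memLp_proj {X : Ω → E} (hX : MemLp X 2 μ) (n : ℤ) : MemLp (proj F₀ μ θ n X) 2 μ :=
  (hX.condExp (by norm_num)).sub (hX.condExp (by norm_num))

lemma stronglyMeasurable_proj (hFT : F₀ ≤ F₀.comap θ) (X : Ω → E) (n : ℤ) :
    StronglyMeasurable[filt F₀ θ n] (proj F₀ μ θ n X) :=
  stronglyMeasurable_condExp.sub
    (stronglyMeasurable_condExp.mono (filt_mono hFT (by omega)))

lemma condExp_proj (hle : ∀ n, filt F₀ θ n ≤ mΩ) (hFT : F₀ ≤ F₀.comap θ) (X : Ω → E) (n : ℤ) :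
    μ[proj F₀ μ θ n X | filt F₀ θ (n - 1)] =ᵐ[μ] 0 := by
  have h1 := condExp_condExp_of_le (f := X) (μ := μ)
    (filt_mono hFT (show n - 1 ≤ n by omega)) (hle n)
  have h2 := condExp_condExp_of_le (f := X) (μ := μ) (le_refl (filt F₀ θ (n - 1))) (hle (n - 1))
  filter_upwards [condExp_sub (m := filt F₀ θ (n - 1))
    (integrable_condExp (m := filt F₀ θ n) (f := X) (μ := μ))
    (integrable_condExp (m := filt F₀ θ (n - 1)) (f := X) (μ := μ)), h1, h2] with ω e1 e2 e3
  rw [proj, e1, Pi.sub_apply, e2, e3]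
  simp

/-- With `m + n = 1` this identifies the terms of the series for `d` with translates of the
projections of `X`. -/
lemma proj_comp_zpow (hθ : ∀ n : ℤ, MeasurePreserving (θ ^ n : Equiv.Perm Ω) μ μ)
    (hle : ∀ n, filt F₀ θ n ≤ mΩ) {X : Ω → E} (hX : Integrable X μ) (m n : ℤ) :
    proj F₀ μ θ (m + n) (X ∘ (θ ^ n : Equiv.Perm Ω)) =ᵐ[μ]
      proj F₀ μ θ m X ∘ (θ ^ n : Equiv.Perm Ω) := by
  have h1 := condExp_comp_comap (hθ n) (hle m) hX
  have h2 := condExp_comp_comap (hθ n) (hle (m - 1)) hX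
  rw [filt_comap_zpow] at h1 h2
  rw [show m - 1 + n = m + n - 1 by ring] at h2
  exact h1.sub h2

/-- The maximal inequality is used with `F_{n-1}` in the role of `F_0`: the projection is measurable
for its preimage `F_n` and has zero expectation given `F_{n-1}`. -/
lemma lpSize_maxFun_proj_le {D : ℝ} (hE : IsTwoSmooth.{u, v} E D)
    (hθ : MeasurePreserving θ μ μ) (hle : ∀ n, filt F₀ θ n ≤ mΩ) (hFT : F₀ ≤ F₀.comap θ)
    {X : Ω → E} (hX : MemLp X 2 μ) (n : ℤ) {p : ℝ} (hp1 : 1 ≤ p) (hp2 : p < 2) :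
    lpSize (maxFun θ (proj F₀ μ θ n X)) p μ ≤
      ENNReal.ofReal (maxConst p * D) * eLpNorm (proj F₀ μ θ n X) 2 μ := by
  have hcomap : (filt F₀ θ (n - 1)).comap θ = filt F₀ θ n := by
    rw [filt_comap, sub_add_cancel]
  refine lpSize_maxFun_le hE hθ (hle (n - 1)) ?_ ?_ (memLp_proj hX n) (condExp_proj hle hFT X n)
    hp1 hp2
  · rw [hcomap]; exact filt_mono hFT (by omega)
  · rw [hcomap]; exact stronglyMeasurable_proj hFT X n

end Projection

end HannanLIL

end

/-! ### The maximal inequality and the martingale approximation -/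

open HannanLIL in
theorem mainTheorem3 :
    ∃ C : ℝ → ℝ, (∀ p : ℝ, 1 ≤ p → p < 2 → 0 < C p) ∧
      ∀ (Ω : Type u) (F₀ : MeasurableSpace Ω) [mΩ : MeasurableSpace Ω]
        (μ : Measure Ω) [IsProbabilityMeasure μ] (θ : Ω ≃ᵐ Ω)
        (E : Type v) [NormedAddCommGroup E] [NormedSpace ℝ E] [CompleteSpace E]
        [TopologicalSpace.SeparableSpace E] (D : ℝ) (X : Ω → E),
        MeasurePreserving θ μ μ →
        F₀ ≤ mΩ →
        F₀ ≤ F₀.comap θ →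
        HannanLIL.IsTwoSmooth.{u, v} E D →
        MemLp X 2 μ →
        HannanLIL.IsRegular F₀ μ θ.toEquiv X →
        HannanLIL.hannanNorm F₀ μ θ.toEquiv X < ∞ →
        (∀ p : ℝ, 1 ≤ p → p < 2 →
          HannanLIL.weakNorm (HannanLIL.maxFun θ.toEquiv X) p μ
            ≤ ENNReal.ofReal (C p * D) * HannanLIL.hannanNorm F₀ μ θ.toEquiv X) ∧
        ∃ d : Ω → E,
          StronglyMeasurable[HannanLIL.filt F₀ θ.toEquiv 1] d ∧
          MemLp d 2 μ ∧
          Tendsto (fun s : Finset ℤ => eLpNorm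
              (∑ n ∈ s, HannanLIL.proj F₀ μ θ.toEquiv 1
                (fun ω => X ((θ.toEquiv ^ n : Equiv.Perm Ω) ω)) - d) 2 μ)
            atTop (𝓝 0) ∧
          μ[d | HannanLIL.filt F₀ θ.toEquiv 0] =ᵐ[μ] 0 ∧
          ∀ᵐ ω ∂μ, (fun n : ℕ => ‖birkhoffSum θ X n ω - birkhoffSum θ d n ω‖)
            =o[atTop] HannanLIL.lilRate := by
  refine ⟨maxConst, fun p => maxConst_pos, ?_⟩
  intro Ω F₀ mΩ μ _ θ E _ _ _ _ D X hθ hF hFT hE hX hreg hH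
  have hpow := measurePreserving_zpow hθ
  set T : Equiv.Perm Ω := θ.toEquiv with hT
  have hT1 : MeasurePreserving T μ μ := hθ
  have hFT' : F₀ ≤ F₀.comap T := hFT
  have hle := filt_le hF fun n => (hpow n).measurable
  have hX1 : Integrable X μ := hX.integrable (by norm_num)
  have hsumX : ∀ᵐ ω ∂μ, HasSum (fun n => proj F₀ μ T n X ω) (X ω) :=
    hasSum_proj (filt_mono hFT') hle hX1 hreg.1 hreg.2 hH.ne
  have hpm : ∀ n, AEStronglyMeasurable (proj F₀ μ T n X) μ := fun n => (memLp_proj hX n).1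
  refine ⟨fun p hp1 hp2 => ?_, ?_⟩
  · refine (weakNorm_le_lpSize (aemeasurable_maxFun hT1 hX.1) hp1).trans ?_
    refine (lpSize_mono_ae hp1 (maxFun_le_tsum hT1 hsumX)).trans ?_
    refine (lpSize_tsum_le (fun n => aemeasurable_maxFun hT1 (hpm n)) hp1).trans ?_
    rw [hannanNorm, ← ENNReal.tsum_mul_left]
    exact ENNReal.tsum_le_tsum fun n => lpSize_maxFun_proj_le hE hT1 hle hFT' hX n hp1 hp2
  set Y : ℤ → Ω → E := fun n => proj F₀ μ T 1 (X ∘ (T ^ n : Equiv.Perm Ω)) with hY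
  have hXn : ∀ n : ℤ, MemLp (X ∘ (T ^ n : Equiv.Perm Ω)) 2 μ := fun n =>
    hX.comp_measurePreserving (hpow n)
  have hYm : ∀ n, AEStronglyMeasurable (Y n) μ := fun n => (memLp_proj (hXn n) 1).1
  -- The reindexing `n ↦ 1 - n` matches each term of `d` with the projection of `X` that it
  -- translates, so both series have the same norms.
  have hYp : ∀ n : ℤ, Y (1 - n) =ᵐ[μ] proj F₀ μ T n X ∘ (T ^ (1 - n) : Equiv.Perm Ω) := by
    intro n
    have := proj_comp_zpow hpow hle hX1 n (1 - n)
    rwa [add_sub_cancel] at this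
  have hYnorm : ∀ n : ℤ, eLpNorm (Y (1 - n)) 2 μ = eLpNorm (proj F₀ μ T n X) 2 μ := by
    intro n
    rw [eLpNorm_congr_ae (hYp n), eLpNorm_comp_measurePreserving (hpm n) (hpow _)]
  have hYsum : ∑' n, eLpNorm (Y n) 2 μ ≠ ∞ := by
    rw [← (Equiv.subLeft (1 : ℤ)).tsum_eq]
    simp only [Equiv.subLeft_apply, hYnorm]
    exact hH.ne
  obtain ⟨hL1, hS⟩ := ae_summable_of_tsum_eLpNorm hYm hYsum
  have hfilt : ∀ n, StronglyMeasurable[filt F₀ T 1] (Y n) := fun n =>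
    stronglyMeasurable_proj hFT' _ 1
  -- The series defines `d` only almost everywhere; conditioning on `F_1` selects a version that is
  -- genuinely `F_1`-measurable.
  set d : Ω → E := μ[fun ω => ∑' n, Y n ω | filt F₀ T 1] with hd
  have hdY : d =ᵐ[μ] fun ω => ∑' n, Y n ω := by
    filter_upwards [condExp_tsum (m := filt F₀ T 1) hYm hL1] with ω e1
    rw [hd, e1]
    refine tsum_congr fun n => ?_
    rw [condExp_of_stronglyMeasurable (hle 1) (hfilt n)
      ((memLp_proj (hXn n) 1).integrable (by norm_num))]
  have hsumd : ∀ᵐ ω ∂μ, HasSum (fun n => Y n ω) (d ω) := by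
    filter_upwards [hdY, hS] with ω e1 e2
    rw [e1]
    exact e2.hasSum
  have hdm : StronglyMeasurable[filt F₀ T 1] d := stronglyMeasurable_condExp
  refine ⟨d, hdm, ⟨(hdm.mono (hle 1)).aestronglyMeasurable, ?_⟩,
    tendsto_eLpNorm_sum_sub hYm hsumd hYsum, ?_, ?_⟩
  · have h1 := eLpNorm_sum_sub_le hYm hsumd ∅
    rw [Finset.sum_empty, zero_sub, eLpNorm_neg] at h1
    exact (h1.trans (ENNReal.tsum_comp_le_tsum_of_injective Subtype.val_injective _)).trans_lt
      hYsum.lt_top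
  · have hY0 : ∀ n, μ[Y n | filt F₀ T 0] =ᵐ[μ] 0 := fun n => by
      simpa using condExp_proj hle hFT' (X ∘ (T ^ n : Equiv.Perm Ω)) 1
    filter_upwards [condExp_congr_ae (m := filt F₀ T 0) hdY,
      condExp_tsum (m := filt F₀ T 0) hYm hL1, ae_all_iff.2 hY0] with ω e1 e2 e3
    rw [e1, e2]
    simp [e3]
  -- Paired in this way, `X - d` becomes a series of coboundaries, up to null sets.
  · have hsumg : ∀ᵐ ω ∂μ, HasSum (fun n => (proj F₀ μ T n X - Y (1 - n)) ω) ((X - d) ω) := by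
      filter_upwards [hsumX, hsumd] with ω e1 e2
      exact e1.sub ((Equiv.subLeft (1 : ℤ)).hasSum_iff.2 e2)
    have hMg : ∑' n, lpSize (maxFun T (proj F₀ μ T n X - Y (1 - n))) 1 μ ≠ ∞ := by
      have h1 : ∀ n, lpSize (maxFun T (proj F₀ μ T n X - Y (1 - n))) 1 μ ≤
          ENNReal.ofReal (maxConst 1 * D) * eLpNorm (proj F₀ μ T n X) 2 μ +
          ENNReal.ofReal (maxConst 1 * D) * eLpNorm (proj F₀ μ T n X) 2 μ := by
        intro n
        refine (lpSize_mono_ae le_rfl (ae_of_all _ (maxFun_sub_le _ _))).trans ?_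
        refine (ENNReal.lintegral_Lp_add_le (aemeasurable_maxFun hT1 (hpm n))
          (aemeasurable_maxFun hT1 (hYm _)) le_rfl).trans ?_
        refine add_le_add (lpSize_maxFun_proj_le hE hT1 hle hFT' hX n le_rfl (by norm_num)) ?_
        refine (lpSize_maxFun_proj_le hE hT1 hle hFT' (hXn (1 - n)) 1 le_rfl
          (by norm_num)).trans (le_of_eq ?_)
        rw [← hYnorm n]
      refine ne_top_of_le_ne_top ?_ (ENNReal.tsum_le_tsum h1)
      rw [ENNReal.tsum_add, ENNReal.tsum_mul_left]
      have : ENNReal.ofReal (maxConst 1 * D) * ∑' n, eLpNorm (proj F₀ μ T n X) 2 μ ≠ ∞ :=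
        ENNReal.mul_ne_top ENNReal.ofReal_ne_top hH.ne
      exact ENNReal.add_ne_top.2 ⟨this, this⟩
    have hcob : ∀ n : ℤ, ∀ᵐ ω ∂μ, Tendsto (fun k : ℕ =>
        ‖birkhoffSum T (proj F₀ μ T n X - Y (1 - n)) k ω‖ / lilRate k) atTop (𝓝 0) := by
      intro n
      filter_upwards [tendsto_birkhoffSum_coboundary hpow (memLp_proj hX n) (1 - n),
        birkhoffSum_ae_eq hT1 ((ae_eq_refl (proj F₀ μ T n X)).sub (hYp n))] with ω e1 e2
      simpa only [e2] using e1
    filter_upwards [isLittleO_birkhoffSum_of_hasSum hT1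
      (fun n => (hpm n).sub (hYm (1 - n))) hsumg hMg hcob] with ω hω
    refine hω.norm_left.congr_left fun n => ?_
    simp only [birkhoffSum, Pi.sub_apply, Finset.sum_sub_distrib]
    rfl
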